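/- **Conventions.** A *Jordan disk* is an open simply connected set $D\subset\mathbb C$ whose topological boundary is a Jordan curve. $A\Subset B$ means $\overline A\subset B$. $\mathrm{mod}(V\setminus\overline U)$ is the conformal modulus of the annulus $V\setminus\overline U$ for Jordan disks $U\Subset V$, and it is $0$ if $U=V$. $\mathrm{Comp}_xS$ is the connected component of $S$ containing $x$. A *complex box mapping* is a holomorphic map $F:\mathcal U\to\mathcal V$ between open sets $\mathcal U\subset\mathcal V\subset\mathbb C$ such that: $F$ has finitely many critical points (the set of them is $\mathrm{Crit}(F)\subset\mathcal U$); $\mathcal V$ is a union of finitely many Jordan disks with disjoint closures; every component $V$ of $\mathcal V$ is either a component of $\mathcal U$, or $V\cap\mathcal U$ is a union of Jordan disks with pairwise disjoint closures, each compactly contained in $V$; and for every component $U$ of $\mathcal U$ the image $F(U)$ is a component of $\mathcal V$ and $F:U\to F(U)$ is proper. Iterates $F^n$ are considered only where they are defined, that is, at points $z$ with $z,\dots,F^{n-1}(z)\in\mathcal U$. A *puzzle piece* of $F$ is a connected component of $F^{-n}(\mathcal V)$ for some $n\ge 0$, and $K(F)=\bigcap_{n\ge0}F^{-n}(\mathcal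 V)$. A box mapping $F_1:\mathcal U_1\to\mathcal V_1$ is *induced* from $F$ if $\mathcal U_1$ and $\mathcal V_1$ are unions of puzzle pieces of $F$ and on every component of $\mathcal U_1$ the map $F_1$ is a composition of (one or more) branches of $F$. A set $B$ is *nice* if $F^k(\partial B)\cap\operatorname{int}B=\emptyset$ for all $k\ge1$. A *puzzle neighborhood* of a finite set $A$ is a union $W\supset A$ of finitely many puzzle pieces such that each component of $W$ intersects $A$. $F$ satisfies the *no permutation condition* if for each component $U$ of $\mathcal U$ there is $n\ge0$ with $F^n(U)\setminus\mathcal U\ne\emptyset$. $F$ is *dynamically natural* if moreover * the set $K_{\text{off-crit}}(F)$ has Lebesgue measure zero, where $K_{\text{off-crit}}(F)$ is the set of $x\in K(F)$ whose forward orbit is disjoint from some puzzle neighborhood of $\mathrm{Crit}(F)$ if $\mathrm{Crit}(F)\neq\emptyset$, and $K_{\text{off-crit}}(F)=K(F)$ if $\mathrm{Crit}(F)=\emptyset$; and * for every $y\in K(F)$ there is $\delta>0$ such that $\limsup_{k\to\infty}m_F(F^k(y))>\delta$, where $m_F(x)=\mathrm{mod}\big(\mathrm{Comp}_x\mathcal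 V\setminus\overline{\mathrm{Comp}_x\mathcal U}\big)$. **Proposition 4.6 (Inducing dynamically natural box mapping).** Let $F:\mathcal U\to\mathcal V$ be a complex box mapping that satisfies the no permutation condition. Assume that each component of $\mathcal V$ contains a critical point of $F$ or a non-empty open set disjoint from $\mathcal U$. Let $\hat{\mathcal U}$ be a finite union of puzzle pieces of $F$ such that $\hat{\mathcal U}$ is a nice set and $\hat{\mathcal U}\Subset\mathcal V$, and let $\mathrm{Crit}_{\hat{\mathcal U}}(F)\subset\mathrm{Crit}(F)$ be the set of critical points of $F$ whose orbits visit $\hat{\mathcal U}$ infinitely many times. Then there exists a dynamically natural complex box mapping $F_1:\mathcal U_1\to\mathcal V_1$, induced from $F$, such that $$\mathrm{Crit}_{\hat{\mathcal U}}(F)\subset\mathrm{Crit}(F_1)\subset\mathrm{Crit}(F).$$ -/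

import Mathlib

open Set Filter Topology MeasureTheory
open scoped ENNReal NNReal

noncomputable section

namespace BoxMap

/-! ### Plane topology -/

/-- `C` is a connected component of the set `S`. -/
def IsComponent (C S : Set ℂ) : Prop :=
  ∃ x ∈ S, C = connectedComponentIn S x

/-- A Jordan curve: an injective continuous image of the circle. -/
def IsJordanCurve (C : Set ℂ) : Prop :=
  ∃ γ : Circle → ℂ, Continuous γ ∧ Function.Injective γ ∧ range γ = C

/-- A Jordan disk: an open simply connected set whose topological boundary is a Jordan curve. -/
def IsJordanDisk (D : Set ℂ) : Prop :=
  IsOpen D ∧ IsSimplyConnected D ∧ IsJordanCurve (frontier D)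

/-- `A` is compactly contained in `B`, in the sense that the closure of `A` lies in `B`. -/
def CompactlyIn (A B : Set ℂ) : Prop :=
  closure A ⊆ B

/-! ### Conformal modulus -/

/-- The rectifiable curves that run inside `A` and join a point of `E` to a point of `E'`,
in a Lipschitz parametrisation on `[0, 1]`. -/
def joiningCurves (A E E' : Set ℂ) : Set (ℝ → ℂ) :=
  {γ | (∃ K : ℝ≥0, LipschitzWith K γ) ∧ γ 0 ∈ E ∧ γ 1 ∈ E' ∧ ∀ t ∈ Ioo (0 : ℝ) 1, γ t ∈ A}

/-- The length of the curve `γ` in the conformal metric `ρ(z) |dz|`. -/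
def metricLength (ρ : ℂ → ℝ≥0∞) (γ : ℝ → ℂ) : ℝ≥0∞ :=
  ∫⁻ t in Ioo (0 : ℝ) 1, ρ (γ t) * ‖deriv γ t‖ₑ

/-- The extremal distance between `E` and `E'` in `A`: the extremal length of the family of
curves joining them, i.e. the reciprocal of the least `ρ`-area of `A` among all Borel metrics `ρ`
for which every curve of the family has length at least `1`. -/
def extremalDistance (A E E' : Set ℂ) : ℝ≥0∞ :=
  (⨅ ρ ∈ {ρ : ℂ → ℝ≥0∞ | Measurable ρ ∧ ∀ γ ∈ joiningCurves A E E', 1 ≤ metricLength ρ γ},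
    ∫⁻ z in A, ρ z ^ 2)⁻¹

open Classical in
/-- The conformal modulus of `V \ closure U`, for Jordan disks `U ⊆ V` that are either equal or
such that `closure U ⊆ V`. In the second case `V \ closure U` is an annulus, and its modulus is the
extremal distance in it between `closure U` and the complement of `V`; this is
`(1 / 2π) log (R / r)` for the annulus `r < |z| < R`. If `U = V` the set is empty and the
modulus is `0`. -/
def modulus (V U : Set ℂ) : ℝ≥0∞ :=
  if V \ closure U = ∅ then 0 else extremalDistance (V \ closure U) (closure U) Vᶜ

/-! ### Partially defined dynamics

A map `F : 𝒰 → 𝒱` is given by a function `F : ℂ → ℂ`, of which only the values on `𝒰` matter. -/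

/-- The `n`-th iterate of `F : 𝒰 → 𝒱` is defined at `z`: the points
`z, F z, …, F^(n-1) z` all lie in `𝒰`. -/
def IterDefined (F : ℂ → ℂ) (𝒰 : Set ℂ) (n : ℕ) (z : ℂ) : Prop :=
  ∀ i < n, F^[i] z ∈ 𝒰

/-- The set of critical points of `F : 𝒰 → 𝒱`. -/
def crit (F : ℂ → ℂ) (𝒰 : Set ℂ) : Set ℂ :=
  {z ∈ 𝒰 | deriv F z = 0}

/-- The preimage `F^(-n)(𝒱)`. -/
def pullback (F : ℂ → ℂ) (𝒰 𝒱 : Set ℂ) (n : ℕ) : Set ℂ :=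
  {z | IterDefined F 𝒰 n z ∧ F^[n] z ∈ 𝒱}

/-- A puzzle piece of some depth `n`: a component of `F^(-n)(𝒱)`. -/
def IsPuzzlePiece (F : ℂ → ℂ) (𝒰 𝒱 P : Set ℂ) : Prop :=
  ∃ n : ℕ, IsComponent P (pullback F 𝒰 𝒱 n)

/-- `W` is a union of puzzle pieces. -/
def IsPuzzleUnion (F : ℂ → ℂ) (𝒰 𝒱 W : Set ℂ) : Prop :=
  ∃ 𝒬 : Set (Set ℂ), (∀ P ∈ 𝒬, IsPuzzlePiece F 𝒰 𝒱 P) ∧ W = ⋃₀ 𝒬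

/-- `W` is a union of finitely many puzzle pieces. -/
def IsFinitePuzzleUnion (F : ℂ → ℂ) (𝒰 𝒱 W : Set ℂ) : Prop :=
  ∃ 𝒬 : Set (Set ℂ), 𝒬.Finite ∧ (∀ P ∈ 𝒬, IsPuzzlePiece F 𝒰 𝒱 P) ∧ W = ⋃₀ 𝒬

/-- The non-escaping set `K(F) = ⋂ n, F^(-n)(𝒱)`. -/
def nonEscaping (F : ℂ → ℂ) (𝒰 𝒱 : Set ℂ) : Set ℂ :=
  ⋂ n : ℕ, pullback F 𝒰 𝒱 n

/-- `B` is nice: `F^k(∂B) ∩ int B = ∅` for all `k ≥ 1`, where `F^k` is applied to the points at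
which it is defined. -/
def IsNice (F : ℂ → ℂ) (𝒰 B : Set ℂ) : Prop :=
  ∀ k : ℕ, 1 ≤ k → ∀ z ∈ frontier B, IterDefined F 𝒰 k z → F^[k] z ∉ interior B

/-- The critical points whose orbit visits `B` infinitely many times. -/
def critVisiting (F : ℂ → ℂ) (𝒰 B : Set ℂ) : Set ℂ :=
  {c ∈ crit F 𝒰 | {n : ℕ | IterDefined F 𝒰 n c ∧ F^[n] c ∈ B}.Infinite}

/-! ### Complex box mappings -/

/-- `F : 𝒰 → 𝒱` is a complex box mapping. -/
structure IsBoxMapping (F : ℂ → ℂ) (𝒰 𝒱 : Set ℂ) : Prop where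
  isOpen_dom : IsOpen 𝒰
  isOpen_cod : IsOpen 𝒱
  dom_subset : 𝒰 ⊆ 𝒱
  mapsTo : MapsTo F 𝒰 𝒱
  holomorphic : DifferentiableOn ℂ F 𝒰
  finite_crit : (crit F 𝒰).Finite
  cod_disks : ∃ 𝒟 : Set (Set ℂ), 𝒟.Finite ∧ (∀ D ∈ 𝒟, IsJordanDisk D) ∧
    (𝒟.Pairwise fun D D' => Disjoint (closure D) (closure D')) ∧ 𝒱 = ⋃₀ 𝒟
  dom_disks : ∀ V, IsComponent V 𝒱 → IsComponent V 𝒰 ∨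
    ∃ 𝒟 : Set (Set ℂ), (∀ D ∈ 𝒟, IsJordanDisk D ∧ CompactlyIn D V) ∧
      (𝒟.Pairwise fun D D' => Disjoint (closure D) (closure D')) ∧ V ∩ 𝒰 = ⋃₀ 𝒟
  image_component : ∀ U, IsComponent U 𝒰 → IsComponent (F '' U) 𝒱
  proper : ∀ U, IsComponent U 𝒰 → IsProperMap ((mapsTo_image F U).restrict F U (F '' U))

/-- `F₁ : 𝒰₁ → 𝒱₁` is induced from `F : 𝒰 → 𝒱`: both `𝒰₁` and `𝒱₁` are unions of puzzle pieces
of `F`, and every branch of `F₁` (its restriction to a component of `𝒰₁`) is a composition of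
`k ≥ 1` branches of `F`. -/
structure IsInduced (F₁ : ℂ → ℂ) (𝒰₁ 𝒱₁ : Set ℂ) (F : ℂ → ℂ) (𝒰 𝒱 : Set ℂ) : Prop where
  dom_union : IsPuzzleUnion F 𝒰 𝒱 𝒰₁
  cod_union : IsPuzzleUnion F 𝒰 𝒱 𝒱₁
  branch : ∀ U, IsComponent U 𝒰₁ →
    ∃ k : ℕ, 1 ≤ k ∧ ∀ z ∈ U, IterDefined F 𝒰 k z ∧ F₁ z = F^[k] z

/-! ### Dynamical naturality -/

/-- The no permutation condition: for each component `U` of `𝒰` there is `n ≥ 0` with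
`F^n(U) \ 𝒰 ≠ ∅`. -/
def NoPermutation (F : ℂ → ℂ) (𝒰 : Set ℂ) : Prop :=
  ∀ U, IsComponent U 𝒰 → ∃ n : ℕ, ∃ z ∈ U, IterDefined F 𝒰 n z ∧ F^[n] z ∉ 𝒰

/-- `W` is a puzzle neighborhood of `A`: a union of finitely many puzzle pieces that contains `A`
and each of whose components intersects `A`. -/
def IsPuzzleNeighborhood (F : ℂ → ℂ) (𝒰 𝒱 W A : Set ℂ) : Prop :=
  IsFinitePuzzleUnion F 𝒰 𝒱 W ∧ A ⊆ W ∧ ∀ C, IsComponent C W → (C ∩ A).Nonempty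

/-- The non-escaping points whose orbit avoids some puzzle neighborhood of the critical set;
all non-escaping points if there are no critical points. -/
def offCrit (F : ℂ → ℂ) (𝒰 𝒱 : Set ℂ) : Set ℂ :=
  {x ∈ nonEscaping F 𝒰 𝒱 | (crit F 𝒰).Nonempty →
    ∃ W, IsPuzzleNeighborhood F 𝒰 𝒱 W (crit F 𝒰) ∧ ∀ n : ℕ, F^[n] x ∉ W}

/-- `m_F(x)`, the modulus of `Comp_x 𝒱 \ closure (Comp_x 𝒰)`. -/
def modulusAt (𝒰 𝒱 : Set ℂ) (x : ℂ) : ℝ≥0∞ :=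
  modulus (connectedComponentIn 𝒱 x) (connectedComponentIn 𝒰 x)

/-- The non-escaping points `y` with `limsup m_F(F^k y) > δ` for some `δ > 0`. -/
def wellInside (F : ℂ → ℂ) (𝒰 𝒱 : Set ℂ) : Set ℂ :=
  {y ∈ nonEscaping F 𝒰 𝒱 | ∃ δ : ℝ, 0 < δ ∧
    ENNReal.ofReal δ < limsup (fun k : ℕ => modulusAt 𝒰 𝒱 (F^[k] y)) atTop}

/-- `F : 𝒰 → 𝒱` is a dynamically natural complex box mapping. -/
structure IsDynamicallyNatural (F : ℂ → ℂ) (𝒰 𝒱 : Set ℂ) : Prop where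
  isBoxMapping : IsBoxMapping F 𝒰 𝒱
  noPermutation : NoPermutation F 𝒰
  volume_offCrit : volume (offCrit F 𝒰 𝒱) = 0
  nonEscaping_eq : nonEscaping F 𝒰 𝒱 = wellInside F 𝒰 𝒱

end BoxMap

end

namespace BoxMap

open Metric

/-! ### Univalent functions on the unit disk -/

/-! The induced map is `F` itself, restricted to those components of `𝒰` that contain a critical
point. There are finitely many of them, no critical point is lost, and absence of permutation is
inherited. So everything reduces to `isDynamicallyNatural_of_finite`: a box mapping with finitely
many branches and no permutation is dynamically natural.

Modulus condition: with finitely many components, the positive values of `modulusAt` have a positive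
lower bound. A non-escaping orbit keeps visiting components compactly contained in their component
of `𝒱`, since otherwise one component would never leave `𝒰` (`exists_component_ne`). `modulus_pos`
gives positivity there.

Measure condition: `offCrit` is a countable union of the sets `avoidingSet F 𝒰 𝒱 n`, which are
compact because deep pullbacks are compactly contained in shallower ones. Away from the critical
pieces `F` is a covering onto components, hence lifts holomorphic disks and is an isometry for the
Kobayashi radius. Compact containment contracts that radius by a definite factor, so the derivatives
of iterates are unbounded (`exists_lt_norm_deriv_iterate`). Expansion excludes interior points.
Univalent inverse branches with Koebe distortion then copy a hole of definite proportion to all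
small scales, so there are no density points (`volume_eq_zero_of_inverse_branches`). -/

/-- A holomorphic function with nonzero derivative has a holomorphic local inverse. -/
lemma exists_differentiableAt_local_inverse {f : ℂ → ℂ} {U : Set ℂ} {z : ℂ}
    (hU : IsOpen U) (hf : DifferentiableOn ℂ f U) (hz : z ∈ U) (hf' : deriv f z ≠ 0) :
    ∃ k : ℂ → ℂ, DifferentiableAt ℂ k (f z) ∧ k (f z) = z ∧
      (∀ᶠ y in 𝓝 z, k (f y) = y) ∧ ∀ᶠ w in 𝓝 (f z), f (k w) = w := by
  have hs : HasStrictDerivAt f (deriv f z) z :=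
    (hf.analyticAt (hU.mem_nhds hz)).hasStrictDerivAt
  have hF := hs.hasStrictFDerivAt_equiv hf'
  exact ⟨hF.localInverse, (hs.to_localInverse hf').hasDerivAt.differentiableAt,
    hF.localInverse_apply_image, hF.eventually_left_inverse, hF.eventually_right_inverse⟩

/-- A continuous lift of a holomorphic function through a locally biholomorphic one is
holomorphic. -/
lemma differentiableAt_of_comp_eq {f φ ψ : ℂ → ℂ} {U : Set ℂ} {z : ℂ} (hU : IsOpen U)
    (hf : DifferentiableOn ℂ f U) (hz : ψ z ∈ U) (hf' : deriv f (ψ z) ≠ 0)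
    (hψ : ContinuousAt ψ z) (hφ : DifferentiableAt ℂ φ z) (h : ∀ᶠ y in 𝓝 z, f (ψ y) = φ y) :
    DifferentiableAt ℂ ψ z := by
  obtain ⟨k, hk, -, hl, -⟩ := exists_differentiableAt_local_inverse hU hf hz hf'
  rw [h.self_of_nhds] at hk
  refine (hk.comp z hφ).congr_of_eventuallyEq ?_
  filter_upwards [hψ.eventually hl, h] with y hy hy'
  simp only [Function.comp_apply, ← hy', hy]

/-- The inverse of an injective holomorphic function with nonvanishing derivative is
holomorphic. -/
lemma differentiableAt_of_injOn_of_leftInv {f h : ℂ → ℂ} {U V : Set ℂ} {w : ℂ}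
    (hU : IsOpen U) (hV : IsOpen V) (hf : DifferentiableOn ℂ f U) (hinj : InjOn f U)
    (hf' : ∀ z ∈ U, deriv f z ≠ 0) (hh : MapsTo h V U) (hfh : ∀ w ∈ V, f (h w) = w)
    (hw : w ∈ V) : DifferentiableAt ℂ h w := by
  obtain ⟨k, hk, hkz, -, hr⟩ :=
    exists_differentiableAt_local_inverse hU hf (hh hw) (hf' _ (hh hw))
  rw [hfh w hw] at hk hkz hr
  refine hk.congr_of_eventuallyEq ?_
  have : ∀ᶠ y in 𝓝 w, k y ∈ U := hk.continuousAt.eventually (by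
    rw [hkz]; exact hU.mem_nhds (hh hw))
  filter_upwards [this, hr, hV.mem_nhds hw] with y h1 h2 h3
  exact hinj (hh h3) h1 (by rw [hfh y h3, h2])

/-- A holomorphic function without zeros on the unit disk has a holomorphic square root. -/
lemma exists_sq_eq_of_ne_zero {u : ℂ → ℂ} (hu : DifferentiableOn ℂ u (ball 0 1))
    (h0 : ∀ z ∈ ball (0 : ℂ) 1, u z ≠ 0) (hu1 : u 0 = 1) :
    ∃ s : ℂ → ℂ, DifferentiableOn ℂ s (ball 0 1) ∧ (∀ z ∈ ball (0 : ℂ) 1, s z ^ 2 = u z) ∧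
      s 0 = 1 := by
  have hsc : IsSimplyConnected (ball (0 : ℂ) 1) := by
    have := (convex_ball (0 : ℂ) 1).contractibleSpace ⟨0, by simp⟩
    exact SimplyConnectedSpace.ofContractible _
  obtain ⟨s, hs, hs2⟩ := Complex.exists_continuousOn_pow_eq hsc isOpen_ball hu.continuousOn
    (by rintro ⟨z, hz, hz'⟩; exact h0 z hz hz') two_ne_zero
  have hsd : DifferentiableOn ℂ s (ball 0 1) := by
    intro z hz
    refine (differentiableAt_of_comp_eq (f := fun z => z ^ 2) (U := univ) isOpen_univ
      (by fun_prop) (mem_univ _) ?_ (hs.continuousAt (isOpen_ball.mem_nhds hz))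
      (hu.differentiableAt (isOpen_ball.mem_nhds hz)) (.of_forall hs2)).differentiableWithinAt
    have : s z ≠ 0 := by
      intro h; apply h0 z hz; rw [← hs2, h]; simp
    simpa using this
  have h1 : s 0 ^ 2 = 1 := by rw [hs2, hu1]
  rcases eq_or_eq_neg_of_sq_eq_sq _ 1 (h1.trans (one_pow 2).symm) with h | h
  · exact ⟨s, hsd, fun z _ => hs2 z, h⟩
  · exact ⟨fun z => - s z, hsd.neg, fun z _ => by rw [neg_sq, hs2], by simp [h]⟩

/-- If the image contained the disk of radius `2`, the Schwarz lemma would bound the derivative of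
the inverse at `0` by `1 / 2`, but it is `1`. The point `w` is an omitted value closest to `0`. -/
lemma exists_ball_subset_image_and_notMem {g : ℂ → ℂ} (hg : DifferentiableOn ℂ g (ball 0 1))
    (hinj : InjOn g (ball 0 1)) (hg' : ∀ z ∈ ball (0 : ℂ) 1, deriv g z ≠ 0)
    (h0 : g 0 = 0) (h1 : deriv g 0 = 1) :
    ∃ w : ℂ, w ≠ 0 ∧ ‖w‖ ≤ 2 ∧ ball 0 ‖w‖ ⊆ g '' ball 0 1 ∧ w ∉ g '' ball 0 1 := by
  have hopen : IsOpen (g '' ball 0 1) := by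
    rw [isOpen_iff_mem_nhds]
    rintro _ ⟨z, hz, rfl⟩
    have hs : HasStrictDerivAt g (deriv g z) z :=
      (hg.analyticAt (isOpen_ball.mem_nhds hz)).hasStrictDerivAt
    rw [← hs.map_nhds_eq (hg' z hz)]
    exact image_mem_map (isOpen_ball.mem_nhds hz)
  have hne : ¬ ball (0 : ℂ) 2 ⊆ g '' ball 0 1 := by
    intro hsub
    choose! h hh hgh using fun w (hw : w ∈ ball (0 : ℂ) 2) => hsub hw
    have hd : ∀ w ∈ ball (0 : ℂ) 2, DifferentiableAt ℂ h w := fun w hw =>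
      differentiableAt_of_injOn_of_leftInv isOpen_ball isOpen_ball hg hinj hg'
        (fun w hw => hh w hw) hgh hw
    have h00 : h 0 = 0 := hinj (hh 0 (by simp)) (by simp) (by rw [hgh 0 (by simp), h0])
    have hle : ‖deriv h 0‖ ≤ 1 / 2 := by
      refine Complex.norm_deriv_le_div_of_mapsTo_ball
        (fun w hw => (hd w hw).differentiableWithinAt) ?_ two_pos
      rw [h00]
      exact fun w hw => ball_subset_closedBall (hh w hw)
    have hcomp : deriv (g ∘ h) 0 = deriv g (h 0) * deriv h 0 :=
      deriv_comp 0 (hg.differentiableAt (isOpen_ball.mem_nhds (hh 0 (by simp)))) (hd 0 (by simp))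
    have hid : deriv (g ∘ h) 0 = 1 := by
      have : g ∘ h =ᶠ[𝓝 0] id := by
        filter_upwards [isOpen_ball.mem_nhds (mem_ball_self (x := (0 : ℂ)) two_pos)] with w hw
        exact hgh w hw
      rw [this.deriv_eq]; simp
    rw [h00, h1, hid, one_mul] at hcomp
    rw [← hcomp] at hle
    norm_num at hle
  obtain ⟨p, hp, hp'⟩ := not_subset.1 hne
  obtain ⟨w, hw, hwd⟩ := hopen.isClosed_compl.exists_infDist_eq_dist ⟨p, hp'⟩ (0 : ℂ)
  rw [dist_zero_left] at hwd
  refine ⟨w, ?_, ?_, ?_, hw⟩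
  · rintro rfl
    exact hw ⟨0, by simp, h0⟩
  · rw [← hwd]
    refine (infDist_le_dist_of_mem hp').trans ?_
    rw [dist_comm]; exact (mem_ball.1 hp).le
  · intro v hv
    by_contra hv'
    have := infDist_le_dist_of_mem (x := (0 : ℂ)) (show v ∈ (g '' ball 0 1)ᶜ from hv')
    rw [hwd, dist_comm] at this
    exact absurd (mem_ball.1 hv) (not_lt.2 this)

/-- A normalized univalent function on the unit disk is bounded on a smaller disk by a universal
constant. -/
lemma norm_le_of_univalent {g : ℂ → ℂ} (hg : DifferentiableOn ℂ g (ball 0 1))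
    (hinj : InjOn g (ball 0 1)) (hg' : ∀ z ∈ ball (0 : ℂ) 1, deriv g z ≠ 0)
    (h0 : g 0 = 0) (h1 : deriv g 0 = 1) {z : ℂ} (hz : ‖z‖ < 1 / 20) : ‖g z‖ ≤ 52 := by
  obtain ⟨w, hw0, hw2, hsub, hwn⟩ := exists_ball_subset_image_and_notMem hg hinj hg' h0 h1
  have hw0' : 0 < ‖w‖ := norm_pos_iff.2 hw0
  -- Square-root trick: `s` cannot take both `v` and `-v` for `v ≠ 0`, because `g` is injective. As
  -- `s` covers a disk about `1`, it omits the disk about `-1`, so `1 / (s + 1)` is bounded.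
  obtain ⟨s, hs, hs2, hs1⟩ := exists_sq_eq_of_ne_zero (u := fun z => 1 - g z / w)
    ((hg.div_const w).const_sub 1) (by
      intro z hz h
      refine hwn ⟨z, hz, ?_⟩
      rw [sub_eq_zero, eq_div_iff hw0] at h
      rw [← h, one_mul]) (by simp [h0])
  choose! h hh hgh using fun v (hv : v ∈ ball (0 : ℂ) ‖w‖) => hsub hv
  have hd : ∀ v ∈ ball (0 : ℂ) ‖w‖, DifferentiableAt ℂ h v := fun v hv =>
    differentiableAt_of_injOn_of_leftInv isOpen_ball isOpen_ball hg hinj hg'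
      (fun w hw => hh w hw) hgh hv
  have h00 : h 0 = 0 := hinj (hh 0 (by simpa)) (by simp) (by rw [hgh 0 (by simpa), h0])
  -- the branch of the square root on the disk around `1`
  have hin : ∀ v ∈ ball (1 : ℂ) (1 / 4), w * (1 - v ^ 2) ∈ ball (0 : ℂ) ‖w‖ := by
    intro v hv
    rw [mem_ball, dist_eq_norm] at hv
    rw [mem_ball_zero_iff, norm_mul]
    have h2 : ‖1 - v ^ 2‖ < 1 := by
      have e : 1 - v ^ 2 = -((v - 1) * ((v - 1) + 2)) := by ring
      rw [e, norm_neg, norm_mul]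
      have : ‖(v - 1) + 2‖ ≤ 1 / 4 + 2 := by
        refine (norm_add_le _ _).trans ?_
        simp only [Complex.norm_ofNat]; linarith
      nlinarith [norm_nonneg (v - 1), norm_nonneg (v - 1 + 2)]
    nlinarith
  have hv0 : ∀ v ∈ ball (1 : ℂ) (1 / 4), v ≠ 0 := by
    rintro v hv rfl
    norm_num [mem_ball, dist_eq_norm] at hv
  set t : ℂ → ℂ := fun v => s (h (w * (1 - v ^ 2))) / v with ht
  have htsq : ∀ v ∈ ball (1 : ℂ) (1 / 4), t v ^ 2 = 1 := by
    intro v hv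
    have := hs2 _ (hh _ (hin v hv))
    simp only [ht, div_pow, this, hgh _ (hin v hv)]
    field_simp [hv0 v hv]
    ring
  have htc : ContinuousOn t (ball 1 (1 / 4)) := by
    have hhc : ContinuousOn h (ball 0 ‖w‖) := fun v hv => (hd v hv).continuousAt.continuousWithinAt
    refine ContinuousOn.div ?_ continuousOn_id hv0
    exact hs.continuousOn.comp (hhc.comp (by fun_prop) (fun v hv => hin v hv))
      (fun v hv => hh _ (hin v hv))
  have ht1 : ∀ v ∈ ball (1 : ℂ) (1 / 4), t v = 1 := by
    have hpre : IsPreconnected (ball (1 : ℂ) (1 / 4)) := (convex_ball _ _).isPreconnected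
    intro v hv
    have e : EqOn t 1 (ball (1 : ℂ) (1 / 4)) := by
      refine IsPreconnected.eq_of_sq_eq hpre htc continuousOn_const
        (fun v hv => by simpa using htsq v hv) (fun _ => by simp)
        (mem_ball_self (by norm_num)) ?_
      simp [ht, h00, hs1]
    exact e hv
  -- If `s z` were within `1 / 4` of `-1`, then `-s z` would be the value of `s` at some second
  -- point. The squares agree, so injectivity of `g` identifies the two points and forces `s z = 0`.
  have homit : ∀ z ∈ ball (0 : ℂ) 1, 1 / 4 ≤ ‖s z + 1‖ := by
    intro z hz
    by_contra! hlt
    have hv : -s z ∈ ball (1 : ℂ) (1 / 4) := by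
      rw [mem_ball, dist_eq_norm, ← norm_neg, neg_sub, sub_neg_eq_add, add_comm]
      exact hlt
    have e1 := ht1 _ hv
    simp only [ht] at e1
    rw [div_eq_one_iff_eq (hv0 _ hv)] at e1
    have hz' := hh _ (hin _ hv)
    have e2 := hs2 _ hz'
    rw [e1] at e2
    replace e2 := ((hs2 z hz).symm.trans (neg_sq (s z)).symm).trans e2
    have e3 : g z = g (h (w * (1 - (-s z) ^ 2))) := by
      have := sub_right_injective e2
      exact (div_left_inj' hw0).1 this
    rw [← hinj hz hz' e3] at e1
    exact hv0 _ hv (by rw [neg_eq_zero]; exact self_eq_neg.1 e1)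
  set τ : ℂ → ℂ := fun z => (s z + 1)⁻¹ with hτ
  have hne : ∀ z ∈ ball (0 : ℂ) 1, s z + 1 ≠ 0 := fun z hz h => by
    have := homit z hz
    rw [h, norm_zero] at this; norm_num at this
  have hτd : DifferentiableOn ℂ τ (ball 0 1) := (hs.add_const 1).inv hne
  have hτ4 : ∀ z ∈ ball (0 : ℂ) 1, ‖τ z‖ ≤ 4 := by
    intro z hz
    rw [hτ, norm_inv]
    calc _ ≤ (1 / 4 : ℝ)⁻¹ := inv_anti₀ (by norm_num) (homit z hz)
      _ = 4 := by norm_num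
  have hτ0 : τ 0 = 1 / 2 := by simp only [hτ, hs1]; norm_num
  have hz1 : z ∈ ball (0 : ℂ) 1 := by rw [mem_ball_zero_iff]; linarith
  -- Since `4 + 1/2 ≤ 5`, for `‖z‖ < 1/20` the value `τ z` moves by at most `1/4` from `1/2`. Hence
  -- `‖τ z‖ ≥ 1/4`, `‖s z‖ ≤ 5`, and `‖g z‖ ≤ 2 * 26`.
  have hdist := Complex.dist_le_div_mul_dist_of_mapsTo_ball (R₂ := 5) hτd (by
    intro y hy
    rw [mem_closedBall, dist_eq_norm, hτ0]
    refine (norm_sub_le _ _).trans ?_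
    have := hτ4 y hy
    norm_num; linarith) hz1
  rw [dist_zero_right, dist_eq_norm, hτ0] at hdist
  have hτl : 1 / 4 ≤ ‖τ z‖ := by
    have : ‖(1 / 2 : ℂ)‖ ≤ ‖τ z‖ + ‖τ z - 1 / 2‖ := by
      rw [norm_sub_rev]
      calc _ = ‖τ z + (1 / 2 - τ z)‖ := by rw [add_sub_cancel]
        _ ≤ _ := norm_add_le _ _
    norm_num at this hdist
    linarith
  have hs4 : ‖s z + 1‖ ≤ 4 := by
    rw [hτ, norm_inv] at hτl
    have h3 : 0 < ‖s z + 1‖ := norm_pos_iff.2 (hne z hz1)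
    rw [le_inv_comm₀ (by norm_num) h3] at hτl
    norm_num at hτl; exact hτl
  have hs5 : ‖s z‖ ≤ 5 := by
    calc ‖s z‖ = ‖(s z + 1) - 1‖ := by ring_nf
      _ ≤ ‖s z + 1‖ + ‖(1 : ℂ)‖ := norm_sub_le _ _
      _ ≤ 5 := by rw [norm_one]; linarith
  have e : g z = w * (1 - s z ^ 2) := by
    rw [hs2 z hz1]; field_simp; ring
  rw [e, norm_mul]
  have : ‖1 - s z ^ 2‖ ≤ 26 := by
    refine (norm_sub_le _ _).trans ?_
    rw [norm_one, norm_pow]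
    nlinarith [norm_nonneg (s z)]
  nlinarith [norm_nonneg w, norm_nonneg (1 - s z ^ 2)]

/-- Koebe distortion with non-optimal constants. -/
lemma univalent_distortion {ψ : ℂ → ℂ} (hψ : DifferentiableOn ℂ ψ (ball 0 1))
    (hinj : InjOn ψ (ball 0 1)) (hψ' : ∀ z ∈ ball (0 : ℂ) 1, deriv ψ z ≠ 0) {z : ℂ}
    (hz : ‖z‖ < 1 / 400000) :
    ‖ψ z - ψ 0‖ ≤ 52 * ‖deriv ψ 0‖ ∧ ‖deriv ψ 0‖ / 2 ≤ ‖deriv ψ z‖ := by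
  set a := deriv ψ 0 with ha
  have ha0 : a ≠ 0 := hψ' 0 (by simp)
  have ha0' : 0 < ‖a‖ := norm_pos_iff.2 ha0
  set g : ℂ → ℂ := fun z => (ψ z - ψ 0) / a with hgdef
  have hgd : ∀ y ∈ ball (0 : ℂ) 1, HasDerivAt g (deriv ψ y / a) y := fun y hy =>
    ((hψ.differentiableAt (isOpen_ball.mem_nhds hy)).hasDerivAt.sub_const _).div_const _
  have hg : DifferentiableOn ℂ g (ball 0 1) := fun y hy =>
    (hgd y hy).differentiableAt.differentiableWithinAt
  have hb : ∀ y : ℂ, ‖y‖ < 1 / 20 → ‖g y‖ ≤ 52 := fun y hy => by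
    refine norm_le_of_univalent hg ?_ ?_ (by simp [hgdef]) ?_ hy
    · intro x hx y hy hxy
      simp only [hgdef] at hxy
      rw [div_left_inj' ha0, sub_left_inj] at hxy
      exact hinj hx hy hxy
    · intro x hx
      rw [(hgd x hx).deriv]
      exact div_ne_zero (hψ' x hx) ha0
    · rw [(hgd 0 (by simp)).deriv, div_self ha0]
  have hg0 : deriv g 0 = 1 := by rw [(hgd 0 (by simp)).deriv, div_self ha0]
  constructor
  · have := hb z (by linarith)
    rw [hgdef, norm_div, div_le_iff₀ ha0'] at this
    exact this
  -- Cauchy estimate on circles of radius `1/80`: the bound is `4160`, so `deriv g` stays within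
  -- `4161` of `1`. The Schwarz lemma on radius `1/40` then gives a deviation of `4161 * 40 / 400000
  -- < 1/2`.
  have hd : ∀ y ∈ ball (0 : ℂ) (1 / 40), ‖deriv g y‖ ≤ 52 / (1 / 80) := by
    intro y hy
    rw [mem_ball_zero_iff] at hy
    refine Complex.norm_deriv_le_of_forall_mem_sphere_norm_le (by norm_num)
      (DifferentiableOn.diffContOnCl_ball (U := ball 0 1) hg ?_) ?_
    · intro x hx
      rw [mem_closedBall, dist_eq_norm] at hx
      rw [mem_ball_zero_iff]
      calc ‖x‖ = ‖(x - y) + y‖ := by ring_nf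
        _ ≤ _ := norm_add_le _ _
        _ < 1 := by linarith
    · intro x hx
      rw [mem_sphere, dist_eq_norm] at hx
      apply hb
      calc ‖x‖ = ‖(x - y) + y‖ := by ring_nf
        _ ≤ _ := norm_add_le _ _
        _ < 1 / 20 := by linarith
  have hdg : DifferentiableOn ℂ (deriv g) (ball 0 (1 / 40)) :=
    (hg.deriv isOpen_ball).mono (ball_subset_ball (by norm_num))
  have hz' : z ∈ ball (0 : ℂ) (1 / 40) := by rw [mem_ball_zero_iff]; linarith
  have hdist := Complex.dist_le_div_mul_dist_of_mapsTo_ball (R₂ := 4161) hdg (by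
    intro y hy
    rw [mem_closedBall, dist_eq_norm, hg0]
    refine (norm_sub_le _ _).trans ?_
    have := hd y hy
    rw [norm_one]; linarith) hz'
  rw [dist_zero_right, dist_eq_norm, hg0] at hdist
  have h2 : 1 / 2 ≤ ‖deriv g z‖ := by
    have : ‖(1 : ℂ)‖ ≤ ‖deriv g z‖ + ‖deriv g z - 1‖ := by
      rw [norm_sub_rev]
      calc _ = ‖deriv g z + (1 - deriv g z)‖ := by rw [add_sub_cancel]
        _ ≤ _ := norm_add_le _ _
    rw [norm_one] at this
    linarith
  rw [(hgd z (by rw [mem_ball_zero_iff]; linarith)).deriv, norm_div, le_div_iff₀ ha0'] at h2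
  linarith

/-! ### Area, density points and null sets -/

/-- A lower bound for the area of the image under an injective holomorphic function. -/
lemma volume_image_ge {ψ : ℂ → ℂ} {S : Set ℂ} (hS : MeasurableSet S)
    (hψ : ∀ z ∈ S, DifferentiableAt ℂ ψ z) (hinj : InjOn ψ S) {m : ℝ} (hm0 : 0 ≤ m)
    (hm : ∀ z ∈ S, m ≤ ‖deriv ψ z‖) :
    ENNReal.ofReal (m ^ 2) * volume S ≤ volume (ψ '' S) := by
  have key := lintegral_abs_det_fderiv_eq_addHaar_image volume hS
    (f' := fun z => (ContinuousLinearMap.toSpanSingleton ℂ (deriv ψ z)).restrictScalars ℝ)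
    (fun z hz => ((hψ z hz).hasDerivAt.hasFDerivAt.restrictScalars ℝ).hasFDerivWithinAt) hinj
  rw [← key, ← setLIntegral_const]
  refine setLIntegral_mono' hS fun z hz => ENNReal.ofReal_le_ofReal ?_
  have : ((ContinuousLinearMap.toSpanSingleton ℂ (deriv ψ z)).restrictScalars ℝ).det =
      ‖deriv ψ z‖ ^ 2 := by
    simp [ContinuousLinearMap.det, LinearMap.det_restrictScalars,
      Algebra.norm_complex_eq, Complex.normSq_eq_norm_sq]
  rw [this, abs_of_nonneg (by positivity)]
  exact pow_le_pow_left₀ hm0 (hm z hz) 2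

/-- A compact set with empty interior leaves a uniform hole in each disk centred at it. -/
lemma exists_uniform_hole {E : Set ℂ} (hE : IsCompact E) (hint : interior E = ∅) {t : ℝ}
    (ht : 0 < t) : ∃ ε > 0, ∀ y ∈ E, ∃ q, ball q ε ⊆ ball y t \ E := by
  refine hE.induction_on (p := fun s => ∃ ε > 0, ∀ y ∈ s, ∃ q, ball q ε ⊆ ball y t \ E)
    ⟨1, one_pos, by simp⟩ ?_ ?_ ?_
  · rintro s s' hs ⟨ε, hε, h⟩
    exact ⟨ε, hε, fun y hy => h y (hs hy)⟩
  · rintro s s' ⟨ε, hε, h⟩ ⟨ε', hε', h'⟩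
    refine ⟨min ε ε', lt_min hε hε', ?_⟩
    rintro y (hy | hy)
    · obtain ⟨q, hq⟩ := h y hy
      exact ⟨q, (ball_subset_ball (min_le_left _ _)).trans hq⟩
    · obtain ⟨q, hq⟩ := h' y hy
      exact ⟨q, (ball_subset_ball (min_le_right _ _)).trans hq⟩
  · intro x hx
    have hne : ¬ ball x (t / 2) ⊆ E := fun h => by
      have : x ∈ interior E := mem_interior.2 ⟨_, h, isOpen_ball, mem_ball_self (by linarith)⟩
      simp [hint] at this
    obtain ⟨p, hp, hpE⟩ := not_subset.1 hne
    have hopen : IsOpen (ball x (t / 2) \ E) := isOpen_ball.sdiff hE.isClosed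
    obtain ⟨ε, hε, hsub⟩ := Metric.isOpen_iff.1 hopen p ⟨hp, hpE⟩
    refine ⟨ball x (t / 2), mem_nhdsWithin_of_mem_nhds (ball_mem_nhds _ (by linarith)),
      ε, hε, fun y hy => ⟨p, hsub.trans (sdiff_subset_sdiff_left ?_)⟩⟩
    refine ball_subset_ball' ?_
    rw [dist_comm]
    linarith [mem_ball.1 hy]

/-- A compact set with empty interior at all of whose points there are arbitrarily contracting
univalent inverse branches is a null set. -/
lemma volume_eq_zero_of_inverse_branches {E : Set ℂ} (hE : IsCompact E) (hint : interior E = ∅)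
    {r : ℝ} (hr : 0 < r)
    (h : ∀ x ∈ E, ∀ ε > 0, ∃ y ∈ E, ∃ ψ : ℂ → ℂ, DifferentiableOn ℂ ψ (ball 0 1) ∧
      InjOn ψ (ball 0 1) ∧ (∀ z ∈ ball (0 : ℂ) 1, deriv ψ z ≠ 0) ∧ ψ 0 = x ∧ ‖deriv ψ 0‖ < ε ∧
      ∀ z ∈ ball (0 : ℂ) 1, ψ z ∈ E → y + r * z ∈ E) : volume E = 0 := by
  by_contra hpos
  -- The hole is sought within `r / 400000` so that, in the coordinate of the inverse branch, it
  -- lies where `univalent_distortion` applies.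
  obtain ⟨ε, hε, hhole⟩ := exists_uniform_hole hE hint (t := r * (1 / 400000)) (by positivity)
  have hdens := Besicovitch.ae_tendsto_measure_inter_div_of_measurableSet
    (volume : Measure ℂ) hE.measurableSet
  have : ∃ x ∈ E, Tendsto (fun ρ => volume (E ∩ closedBall x ρ) / volume (closedBall x ρ))
      (𝓝[>] 0) (𝓝 1) := by
    by_contra! hcon
    refine hpos (measure_mono_null ?_ hdens)
    intro x hx hx'
    rw [mem_ofPred_eq, indicator_of_mem hx] at hx'
    exact hcon x hx hx'
  obtain ⟨x, hxE, hx⟩ := this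
  -- the proportion of the hole
  set κ : ℝ := (ε / r) ^ 2 / (4 * 52 ^ 2) with hκ
  have hκ0 : 0 < κ := by positivity
  have hev : ∀ᶠ ρ in 𝓝[>] (0 : ℝ),
      1 - ENNReal.ofReal κ < volume (E ∩ closedBall x ρ) / volume (closedBall x ρ) :=
    hx.eventually (lt_mem_nhds
      (ENNReal.sub_lt_self ENNReal.one_ne_top one_ne_zero (by simpa using hκ0)))
  obtain ⟨ρ₀, hρ₀, hρ⟩ := mem_nhdsGT_iff_exists_Ioo_subset.1 hev
  obtain ⟨y, hy, ψ, hψ, hinj, hψ', hψ0, hlt, hψE⟩ := h x hxE (ρ₀ / 52) (by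
    have : 0 < ρ₀ := hρ₀
    positivity)
  set a := ‖deriv ψ 0‖ with ha
  have ha0 : 0 < a := norm_pos_iff.2 (hψ' 0 (by simp))
  have hρa := hρ (show 52 * a ∈ Ioo 0 ρ₀ from ⟨by positivity, by linarith⟩)
  obtain ⟨q, hq⟩ := hhole y hy
  set S : Set ℂ := ball ((q - y) / r) (ε / r) with hSdef
  have hr' : (r : ℂ) ≠ 0 := by exact_mod_cast hr.ne'
  have hS : ∀ z ∈ S, y + r * z ∈ ball q ε := by
    intro z hz
    rw [hSdef, mem_ball, dist_eq_norm] at hz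
    rw [mem_ball, dist_eq_norm]
    have e : y + r * z - q = r * (z - (q - y) / r) := by field_simp; ring
    rw [e, norm_mul, Complex.norm_real, Real.norm_of_nonneg hr.le]
    rwa [lt_div_iff₀' hr] at hz
  have hS2 : ∀ z ∈ S, ‖z‖ < 1 / 400000 := by
    intro z hz
    have := (hq (hS z hz)).1
    rw [mem_ball, dist_eq_norm, add_sub_cancel_left, norm_mul, Complex.norm_real,
      Real.norm_of_nonneg hr.le] at this
    exact lt_of_mul_lt_mul_left this hr.le
  have hS1 : ∀ z ∈ S, z ∈ ball (0 : ℂ) 1 := fun z hz => by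
    rw [mem_ball_zero_iff]; linarith [hS2 z hz]
  have hsub : ψ '' S ⊆ closedBall x (52 * a) \ E := by
    rintro _ ⟨z, hz, rfl⟩
    refine ⟨?_, fun hz' => (hq (hS z hz)).2 (hψE z (hS1 z hz) hz')⟩
    rw [mem_closedBall, dist_eq_norm, ← hψ0]
    exact (univalent_distortion hψ hinj hψ' (hS2 z hz)).1
  have hvol := volume_image_ge (S := S) measurableSet_ball
    (fun z hz => hψ.differentiableAt (isOpen_ball.mem_nhds (hS1 z hz)))
    (hinj.mono hS1) (m := a / 2) (by positivity)
    (fun z hz => (univalent_distortion hψ hinj hψ' (hS2 z hz)).2)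
  have hle : ENNReal.ofReal κ * volume (closedBall x (52 * a)) ≤
      volume (closedBall x (52 * a) \ E) := by
    -- The image of the hole has area at least `(a / 2) ^ 2` times that of `S`. Its ratio to the
    -- disk of radius `52 * a` is `κ`, whatever `a` is.
    refine le_trans (le_of_eq ?_) (hvol.trans (measure_mono hsub))
    rw [Complex.volume_closedBall, hSdef, Complex.volume_ball, ← mul_assoc, ← mul_assoc,
      ← ENNReal.ofReal_pow (by positivity), ← ENNReal.ofReal_pow (by positivity),
      ← ENNReal.ofReal_mul hκ0.le, ← ENNReal.ofReal_mul (by positivity)]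
    congr 2
    rw [hκ]; ring
  have hfin : volume (closedBall x (52 * a)) ≠ ∞ := measure_closedBall_lt_top.ne
  have hpos' : volume (closedBall x (52 * a)) ≠ 0 :=
    (measure_closedBall_pos volume x (by positivity)).ne'
  have hsum : volume (E ∩ closedBall x (52 * a)) / volume (closedBall x (52 * a)) +
      ENNReal.ofReal κ ≤ 1 := by
    calc _ = (volume (closedBall x (52 * a) ∩ E) +
          ENNReal.ofReal κ * volume (closedBall x (52 * a))) / volume (closedBall x (52 * a)) := by
          rw [ENNReal.add_div, mul_div_assoc, ENNReal.div_self hpos' hfin, mul_one, inter_comm]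
      _ ≤ volume (closedBall x (52 * a)) / volume (closedBall x (52 * a)) := by
          gcongr
          calc _ ≤ _ := add_le_add_right hle _
            _ = _ := measure_inter_add_sdiff _ hE.measurableSet
      _ = 1 := ENNReal.div_self hpos' hfin
  have := ENNReal.le_sub_of_add_le_right ENNReal.ofReal_ne_top hsum
  exact absurd hρa (not_lt.2 this)

/-! ### The Kobayashi radius -/

/-- The supremum of `|φ'(0)|` over holomorphic maps `φ` of the unit disk into `A` with
`φ 0 = x`. -/
noncomputable def kobayashiRadius (A : Set ℂ) (x : ℂ) : ℝ≥0∞ :=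
  ⨆ φ ∈ {φ : ℂ → ℂ | DifferentiableOn ℂ φ (ball 0 1) ∧ MapsTo φ (ball 0 1) A ∧ φ 0 = x},
    ‖deriv φ 0‖ₑ

lemma le_kobayashiRadius {A : Set ℂ} {x : ℂ} {φ : ℂ → ℂ} (hφ : DifferentiableOn ℂ φ (ball 0 1))
    (hA : MapsTo φ (ball 0 1) A) (hx : φ 0 = x) : ‖deriv φ 0‖ₑ ≤ kobayashiRadius A x :=
  le_iSup₂_of_le φ ⟨hφ, hA, hx⟩ le_rfl

lemma ofReal_le_kobayashiRadius {A : Set ℂ} {x : ℂ} {r : ℝ} (hr : 0 < r) (h : ball x r ⊆ A) :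
    ENNReal.ofReal r ≤ kobayashiRadius A x := by
  have hd : HasDerivAt (fun z : ℂ => x + r * z) r 0 := by
    simpa using ((hasDerivAt_id (0 : ℂ)).const_mul (r : ℂ)).const_add x
  refine le_trans (le_of_eq ?_) (le_kobayashiRadius (φ := fun z => x + r * z)
    (by fun_prop) ?_ (by simp))
  · rw [hd.deriv, enorm_eq_nnnorm, ENNReal.ofReal, ENNReal.coe_inj]
    ext
    simp [hr.le, abs_of_pos hr]
  · intro z hz
    apply h
    rw [mem_ball_zero_iff] at hz
    rw [mem_ball, dist_eq_norm, add_sub_cancel_left, norm_mul, Complex.norm_real,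
      Real.norm_of_nonneg hr.le]
    nlinarith

lemma kobayashiRadius_le_of_subset_closedBall {A : Set ℂ} {x c : ℂ} {C : ℝ}
    (h : A ⊆ closedBall c C) : kobayashiRadius A x ≤ ENNReal.ofReal (2 * C) := by
  refine iSup₂_le fun φ hφ => ?_
  obtain ⟨hφ, hA, rfl⟩ := hφ
  have h0 := h (hA (show (0 : ℂ) ∈ ball (0 : ℂ) 1 by simp))
  have := Complex.norm_deriv_le_div_of_mapsTo_ball (R₂ := 2 * C) hφ (fun z hz => by
    have h1 := h (hA hz)
    rw [mem_closedBall] at h0 h1 ⊢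
    have := dist_triangle_right (φ z) (φ 0) c
    linarith) one_pos
  rw [div_one] at this
  rw [← ofReal_norm]
  exact ENNReal.ofReal_le_ofReal this

/-- Strict contraction of the Kobayashi radius under compact inclusion. -/
lemma exists_mul_kobayashiRadius_le {A A' Q : Set ℂ} (hQ : IsCompact Q) (hA : IsOpen A)
    (hA' : A' ⊆ Q) (hQA : Q ⊆ A) :
    ∃ q : ℝ≥0∞, 1 < q ∧ q ≠ ∞ ∧ ∀ x, q * kobayashiRadius A' x ≤ kobayashiRadius A x := by
  obtain ⟨δ, hδ, hsub⟩ := hQ.exists_thickening_subset_open hA hQA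
  obtain ⟨C, hC0, hC⟩ := hQ.isBounded.subset_closedBall_lt 0 0
  -- The competitor will be `φ + ε (φ - φ 0)`. Its derivative at `0` gains the factor `1 + ε`, and
  -- it moves points by at most `2 * C * ε = δ / 2`, so it stays in `A`.
  set ε : ℝ := δ / (4 * C) with hε
  have hε0 : 0 < ε := by positivity
  refine ⟨ENNReal.ofReal (1 + ε), by
    rw [← ENNReal.ofReal_one]
    exact (ENNReal.ofReal_lt_ofReal_iff (by linarith)).2 (by linarith), ENNReal.ofReal_ne_top,
    fun x => ?_⟩
  simp only [kobayashiRadius, ENNReal.mul_iSup]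
  refine iSup₂_le fun φ hφ => ?_
  obtain ⟨hφ, hφA, rfl⟩ := hφ
  have h0 : (0 : ℂ) ∈ ball (0 : ℂ) 1 := by simp
  have hd : HasDerivAt (fun z => φ z + ε * (φ z - φ 0)) (deriv φ 0 + ε * deriv φ 0) 0 := by
    have := (hφ.differentiableAt (isOpen_ball.mem_nhds h0)).hasDerivAt
    exact this.add ((this.sub_const _).const_mul _)
  refine le_trans (le_of_eq ?_) (le_kobayashiRadius (φ := fun z => φ z + ε * (φ z - φ 0))
    (hφ.add ((hφ.sub_const _).const_mul _)) ?_ (by simp))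
  · have e : deriv φ 0 + ε * deriv φ 0 = ((1 + ε : ℝ) : ℂ) * deriv φ 0 := by push_cast; ring
    rw [hd.deriv, e, enorm_mul, ← ofReal_norm ((1 + ε : ℝ) : ℂ), Complex.norm_real,
      Real.norm_of_nonneg (by linarith)]
  · intro z hz
    apply hsub
    rw [mem_thickening_iff]
    refine ⟨φ z, hA' (hφA hz), ?_⟩
    have h1 := hC (hA' (hφA hz))
    have h2 := hC (hA' (hφA h0))
    rw [mem_closedBall_zero_iff] at h1 h2
    rw [dist_eq_norm, add_sub_cancel_left, norm_mul, Complex.norm_real,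
      Real.norm_of_nonneg hε0.le]
    have : ‖φ z - φ 0‖ ≤ 2 * C := (norm_sub_le _ _).trans (by linarith)
    calc ε * ‖φ z - φ 0‖ ≤ ε * (2 * C) := by gcongr
      _ = δ / 2 := by rw [hε]; field_simp; norm_num
      _ < δ := by linarith

/-- The Schwarz-Pick inequality for the Kobayashi radius. -/
lemma enorm_deriv_mul_kobayashiRadius_le {A A' U : Set ℂ} {f : ℂ → ℂ} {x : ℂ} (hU : IsOpen U)
    (hf : DifferentiableOn ℂ f U) (hAU : A' ⊆ U) (hA : MapsTo f A' A) :
    ‖deriv f x‖ₑ * kobayashiRadius A' x ≤ kobayashiRadius A (f x) := by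
  simp only [kobayashiRadius, ENNReal.mul_iSup]
  refine iSup₂_le fun φ hφ => ?_
  obtain ⟨hφ, hφA, rfl⟩ := hφ
  have h0 : (0 : ℂ) ∈ ball (0 : ℂ) 1 := by simp
  have hd : deriv (f ∘ φ) 0 = deriv f (φ 0) * deriv φ 0 :=
    deriv_comp 0 (hf.differentiableAt (hU.mem_nhds (hAU (hφA h0))))
      (hφ.differentiableAt (isOpen_ball.mem_nhds h0))
  rw [← enorm_mul, ← hd]
  exact le_kobayashiRadius (hf.comp hφ fun z hz => hAU (hφA hz)) (hA.comp hφA) rfl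

/-! ### Components of open sets -/

lemma isComponent_connectedComponentIn {S : Set ℂ} {x : ℂ} (hx : x ∈ S) :
    IsComponent (connectedComponentIn S x) S := ⟨x, hx, rfl⟩

lemma IsComponent.subset {C S : Set ℂ} (h : IsComponent C S) : C ⊆ S := by
  obtain ⟨x, -, rfl⟩ := h
  exact connectedComponentIn_subset _ _

lemma IsComponent.nonempty {C S : Set ℂ} (h : IsComponent C S) : C.Nonempty := by
  obtain ⟨x, hx, rfl⟩ := h
  exact ⟨x, mem_connectedComponentIn hx⟩

lemma IsComponent.isPreconnected {C S : Set ℂ} (h : IsComponent C S) : IsPreconnected C := by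
  obtain ⟨x, -, rfl⟩ := h
  exact isPreconnected_connectedComponentIn

lemma IsComponent.isOpen {C S : Set ℂ} (h : IsComponent C S) (hS : IsOpen S) : IsOpen C := by
  obtain ⟨x, -, rfl⟩ := h
  exact hS.connectedComponentIn

lemma IsComponent.eq_connectedComponentIn {C S : Set ℂ} {x : ℂ} (h : IsComponent C S)
    (hx : x ∈ C) : C = connectedComponentIn S x := by
  obtain ⟨y, -, rfl⟩ := h
  exact connectedComponentIn_eq hx

lemma IsComponent.subset_of_isPreconnected {C S T : Set ℂ} {x : ℂ} (h : IsComponent C S)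
    (hT : IsPreconnected T) (hTS : T ⊆ S) (hxT : x ∈ T) (hxC : x ∈ C) : T ⊆ C := by
  rw [h.eq_connectedComponentIn hxC]
  exact hT.subset_connectedComponentIn hxT hTS

lemma IsComponent.isOpen_sdiff {C S : Set ℂ} (h : IsComponent C S) (hS : IsOpen S) :
    IsOpen (S \ C) := by
  rw [isOpen_iff_mem_nhds]
  rintro x ⟨hx, hxC⟩
  refine mem_of_superset (connectedComponentIn_mem_nhds (hS.mem_nhds hx)) fun y hy => ?_
  refine ⟨connectedComponentIn_subset _ _ hy, fun hyC => hxC ?_⟩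
  rw [h.eq_connectedComponentIn hyC, ← connectedComponentIn_eq hy]
  exact mem_connectedComponentIn hx

lemma IsComponent.isCompact_inter {C S K : Set ℂ} (h : IsComponent C S) (hS : IsOpen S)
    (hK : IsCompact K) (hKS : K ⊆ S) : IsCompact (K ∩ C) := by
  have : K ∩ C = K \ (S \ C) := by
    ext x
    constructor
    · rintro ⟨h1, h2⟩; exact ⟨h1, fun h => h.2 h2⟩
    · rintro ⟨h1, h2⟩; exact ⟨h1, by by_contra h3; exact h2 ⟨hKS h1, h3⟩⟩
  rw [this]
  exact hK.diff (h.isOpen_sdiff hS)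

/-- The components of a disjoint union of open connected sets are its members. -/
lemma mem_of_isComponent_sUnion {𝒟 : Set (Set ℂ)} {C : Set ℂ} (hop : ∀ D ∈ 𝒟, IsOpen D)
    (hcon : ∀ D ∈ 𝒟, IsPreconnected D) (hdis : 𝒟.Pairwise Disjoint)
    (hC : IsComponent C (⋃₀ 𝒟)) : C ∈ 𝒟 := by
  obtain ⟨x, ⟨D, hD, hxD⟩, rfl⟩ := hC
  suffices connectedComponentIn (⋃₀ 𝒟) x = D by rwa [this]
  refine subset_antisymm ?_
    ((hcon D hD).subset_connectedComponentIn hxD (subset_sUnion_of_mem hD))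
  have hx : x ∈ ⋃₀ 𝒟 := ⟨D, hD, hxD⟩
  refine IsPreconnected.subset_left_of_subset_union (v := ⋃₀ (𝒟 \ {D})) (hop D hD)
    (isOpen_sUnion fun D' hD' => hop D' hD'.1) ?_ ?_ ⟨x, mem_connectedComponentIn hx, hxD⟩
    isPreconnected_connectedComponentIn
  · rw [disjoint_sUnion_right]
    exact fun D' hD' => hdis hD hD'.1 (Ne.symm hD'.2)
  · refine (connectedComponentIn_subset _ _).trans ?_
    rintro y ⟨D', hD', hy⟩
    by_cases h : D' = D
    · exact .inl (h ▸ hy)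
    · exact .inr ⟨D', ⟨hD', h⟩, hy⟩

/-! ### Jordan disks -/

lemma IsJordanDisk.isPreconnected {D : Set ℂ} (h : IsJordanDisk D) : IsPreconnected D :=
  h.2.1.isPathConnected.isConnected.isPreconnected

lemma IsJordanCurve.isCompact {C : Set ℂ} (h : IsJordanCurve C) : IsCompact C := by
  obtain ⟨γ, hγ, -, rfl⟩ := h
  exact isCompact_range hγ

lemma IsJordanCurve.nonempty {C : Set ℂ} (h : IsJordanCurve C) : C.Nonempty := by
  obtain ⟨γ, -, -, rfl⟩ := h
  exact range_nonempty γ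

lemma isPreconnected_norm_gt {R : ℝ} (hR : 0 < R) : IsPreconnected {z : ℂ | R < ‖z‖} := by
  have : {z : ℂ | R < ‖z‖} = Complex.exp '' {z | Real.log R < z.re} := by
    ext z
    constructor
    · intro hz
      have hz0 : z ≠ 0 := by
        rintro rfl
        rw [mem_ofPred_eq, norm_zero] at hz
        linarith
      exact ⟨Complex.log z, by
        rw [mem_ofPred_eq, Complex.log_re]; exact Real.log_lt_log hR hz, Complex.exp_log hz0⟩
    · rintro ⟨w, hw, rfl⟩
      rw [mem_ofPred_eq, Complex.norm_exp]
      exact (Real.log_lt_iff_lt_exp hR).1 hw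
  rw [this]
  exact ((convex_halfSpace_re_gt _).isPreconnected).image _ Complex.continuous_exp.continuousOn

/-- On a set containing a round circle there is no continuous logarithm of `z - p` for `p` inside
the circle. -/
lemma not_continuousOn_log_of_circle_subset {D : Set ℂ} {p : ℂ} {ρ : ℝ} (hρ : 0 < ρ)
    (hD : ∀ θ : ℝ, p + ρ * Complex.exp (θ * Complex.I) ∈ D) {f : ℂ → ℂ} (hf : ContinuousOn f D)
    (hexp : ∀ z ∈ D, Complex.exp (f z) = z - p) : False := by
  have hρ' : (ρ : ℂ) ≠ 0 := by exact_mod_cast hρ.ne'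
  set c : ℝ → ℂ := fun θ => p + ρ * Complex.exp (θ * Complex.I) with hc
  have hcc : Continuous c := by fun_prop
  have h1 : Continuous (fun θ => f (c θ)) := hf.comp_continuous hcc hD
  have h2 : Continuous (fun θ : ℝ => (θ : ℂ) * Complex.I + f (c 0)) := by fun_prop
  -- Both functions lift the same loop through `exp` and agree at `0`. By uniqueness of lifts they
  -- coincide, yet only one of them is periodic.
  have key := Complex.isCoveringMap_exp.eq_of_comp_eq h1 h2 (by
    ext θ
    simp only [Function.comp_apply]
    rw [hexp _ (hD θ), Complex.exp_add, hexp _ (hD 0)]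
    simp [mul_comm]) 0 (by simp)
  have := congr_fun key (2 * Real.pi)
  have e : c (2 * Real.pi) = c 0 := by
    simp only [hc]
    push_cast
    rw [Complex.exp_two_pi_mul_I]
    simp
  simp only [e] at this
  have h3 : (((2 * Real.pi : ℝ) : ℂ) * Complex.I) = 0 := by
    linear_combination -this
  simp [Real.pi_ne_zero] at h3

/-- The exterior of a Jordan curve also has a Jordan curve as frontier; simple connectivity excludes
it. An unbounded `D` with compact frontier contains a neighbourhood of infinity, hence a large
circle about a frontier point `p`. But `z - p` has a continuous logarithm on the simply connected
`D`. -/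
lemma IsJordanDisk.isBounded {D : Set ℂ} (h : IsJordanDisk D) : Bornology.IsBounded D := by
  obtain ⟨hop, hsc, hfr⟩ := h
  obtain ⟨R, hR0, hR⟩ := hfr.isCompact.isBounded.subset_closedBall_lt 0 0
  obtain ⟨p, hp⟩ := hfr.nonempty
  have hpD : p ∉ D := fun h => (disjoint_frontier_iff_isOpen.2 hop).le_bot ⟨hp, h⟩
  by_contra hunb
  have hne : ({z : ℂ | R < ‖z‖} ∩ D).Nonempty := by
    by_contra hemp
    refine hunb ((isBounded_closedBall (x := (0 : ℂ)) (r := R)).subset fun z hz => ?_)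
    rw [mem_closedBall_zero_iff]
    by_contra! hlt
    exact hemp ⟨z, hlt, hz⟩
  have hsub : {z : ℂ | R < ‖z‖} ⊆ D := by
    refine (isPreconnected_norm_gt hR0).subset_of_closure_inter_subset hop hne ?_
    rintro z ⟨hz1, hz2⟩
    by_contra hzD
    have : z ∈ frontier D := by rw [hop.frontier_eq]; exact ⟨hz1, hzD⟩
    have := hR this
    rw [mem_closedBall_zero_iff] at this
    exact absurd hz2 (not_lt.2 this)
  obtain ⟨f, hf, hfe⟩ := Complex.exists_continuousOn_eqOn_exp_comp hsc hop
    (g := fun z => z - p) (by fun_prop) (by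
      rintro ⟨z, hz, hz'⟩
      rw [sub_eq_zero] at hz'
      exact hpD (hz' ▸ hz))
  refine not_continuousOn_log_of_circle_subset (ρ := ‖p‖ + R + 1) (by positivity)
    (fun θ => hsub ?_) hf fun z hz => hfe hz
  rw [mem_ofPred_eq]
  have h1 : ‖((‖p‖ + R + 1 : ℝ) : ℂ) * Complex.exp (θ * Complex.I)‖ = ‖p‖ + R + 1 := by
    rw [norm_mul, Complex.norm_exp_ofReal_mul_I, mul_one, Complex.norm_real,
      Real.norm_of_nonneg (by positivity)]
  have h2 := norm_sub_le (p + ((‖p‖ + R + 1 : ℝ) : ℂ) * Complex.exp (θ * Complex.I)) p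
  rw [add_sub_cancel_left, h1] at h2
  linarith

/-! ### Pullbacks -/

section Pullback

variable {F : ℂ → ℂ} {𝒰 𝒱 : Set ℂ}

lemma iterDefined_succ {n : ℕ} {z : ℂ} :
    IterDefined F 𝒰 (n + 1) z ↔ z ∈ 𝒰 ∧ IterDefined F 𝒰 n (F z) := by
  constructor
  · intro h
    exact ⟨h 0 (by omega), fun i hi => h (i + 1) (by omega)⟩
  · rintro ⟨h0, h⟩ (_ | i) hi
    · exact h0
    · exact h i (by omega)

lemma pullback_zero : pullback F 𝒰 𝒱 0 = 𝒱 := by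
  ext z
  simp [pullback, IterDefined]

lemma pullback_succ (n : ℕ) : pullback F 𝒰 𝒱 (n + 1) = 𝒰 ∩ F ⁻¹' pullback F 𝒰 𝒱 n := by
  ext z
  simp only [pullback, mem_ofPred_eq, iterDefined_succ, mem_inter_iff, mem_preimage,
    Function.iterate_succ_apply, and_assoc]

lemma mapsTo_nonEscaping : MapsTo F (nonEscaping F 𝒰 𝒱) (nonEscaping F 𝒰 𝒱) := by
  intro x hx
  simp only [nonEscaping, mem_iInter] at hx ⊢
  intro n
  have := hx (n + 1)
  rw [pullback_succ] at this
  exact this.2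

lemma iterate_mem_nonEscaping {x : ℂ} (hx : x ∈ nonEscaping F 𝒰 𝒱) (n : ℕ) :
    F^[n] x ∈ nonEscaping F 𝒰 𝒱 :=
  mapsTo_nonEscaping.iterate n hx

lemma nonEscaping_subset : nonEscaping F 𝒰 𝒱 ⊆ 𝒰 := fun x hx => by
  have := mem_iInter.1 hx 1
  rw [pullback_succ] at this
  exact this.1

namespace IsBoxMapping

variable (hF : IsBoxMapping F 𝒰 𝒱)

include hF

lemma pullback_one : pullback F 𝒰 𝒱 1 = 𝒰 := by
  rw [pullback_succ, pullback_zero]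
  exact inter_eq_left.2 hF.mapsTo

lemma isOpen_pullback (n : ℕ) : IsOpen (pullback F 𝒰 𝒱 n) := by
  induction n with
  | zero => rw [pullback_zero]; exact hF.isOpen_cod
  | succ n ih =>
    rw [pullback_succ]
    exact hF.holomorphic.continuousOn.isOpen_inter_preimage hF.isOpen_dom ih

lemma pullback_antitone : Antitone (pullback F 𝒰 𝒱) := by
  refine antitone_nat_of_succ_le fun n => ?_
  induction n with
  | zero => rw [hF.pullback_one, pullback_zero]; exact hF.dom_subset
  | succ n ih =>
    rw [pullback_succ (n + 1)]
    nth_rw 2 [pullback_succ n]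
    exact inter_subset_inter_right _ (preimage_mono ih)

lemma pullback_subset_cod (n : ℕ) : pullback F 𝒰 𝒱 n ⊆ 𝒱 :=
  (hF.pullback_antitone (Nat.zero_le n)).trans pullback_zero.subset

lemma isCompact_inter_preimage {U K : Set ℂ} (hU : IsComponent U 𝒰) (hK : IsCompact K)
    (hKU : K ⊆ F '' U) : IsCompact (U ∩ F ⁻¹' K) := by
  have hK' : IsCompact ((↑) ⁻¹' K : Set (F '' U)) := by
    rw [Subtype.isCompact_iff, Subtype.image_preimage_coe, inter_eq_right.2 hKU]
    exact hK
  have := Subtype.isCompact_iff.1 ((hF.proper U hU).isCompact_preimage hK')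
  convert this using 1
  ext z
  constructor
  · rintro ⟨h1, h2⟩
    exact ⟨⟨z, h1⟩, h2, rfl⟩
  · rintro ⟨⟨w, hw⟩, h2, rfl⟩
    exact ⟨hw, h2⟩

lemma image_eq_connectedComponentIn {U : Set ℂ} {z : ℂ} (hU : IsComponent U 𝒰) (hz : z ∈ U) :
    F '' U = connectedComponentIn 𝒱 (F z) :=
  (hF.image_component U hU).eq_connectedComponentIn (mem_image_of_mem F hz)

lemma isJordanDisk_of_isComponent {V : Set ℂ} (hV : IsComponent V 𝒱) : IsJordanDisk V := by
  obtain ⟨𝒟, -, hJ, hdis, rfl⟩ := hF.cod_disks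
  exact hJ V (mem_of_isComponent_sUnion (fun D hD => (hJ D hD).1)
    (fun D hD => (hJ D hD).isPreconnected)
    (fun D hD D' hD' h => (hdis hD hD' h).mono subset_closure subset_closure) hV)

lemma isBounded_cod : Bornology.IsBounded 𝒱 := by
  obtain ⟨𝒟, hfin, hJ, -, rfl⟩ := hF.cod_disks
  exact (Bornology.isBounded_sUnion hfin).2 fun D hD => (hJ D hD).isBounded

omit hF in
/-- The members of a decomposition of `V ∩ 𝒰` into disjoint Jordan disks are components
of `𝒰`. -/
lemma _root_.BoxMap.isComponent_iff_mem_of_inter_eq {V : Set ℂ} {𝒟 : Set (Set ℂ)}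
    (hsub : 𝒰 ⊆ 𝒱) (hV : IsComponent V 𝒱)
    (hJ : ∀ D ∈ 𝒟, IsJordanDisk D)
    (hdis : 𝒟.Pairwise fun D D' => Disjoint (closure D) (closure D')) (h : V ∩ 𝒰 = ⋃₀ 𝒟)
    {D : Set ℂ} : D ∈ 𝒟 ↔ IsComponent D 𝒰 ∧ D ⊆ V := by
  have hdis' : 𝒟.Pairwise Disjoint :=
    fun D hD D' hD' h => (hdis hD hD' h).mono subset_closure subset_closure
  have key : ∀ x ∈ V ∩ 𝒰, connectedComponentIn 𝒰 x ∈ 𝒟 := by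
    intro x hx
    have hsubV : connectedComponentIn 𝒰 x ⊆ V :=
      hV.subset_of_isPreconnected isPreconnected_connectedComponentIn
        ((connectedComponentIn_subset _ _).trans hsub) (mem_connectedComponentIn hx.2) hx.1
    have : connectedComponentIn 𝒰 x = connectedComponentIn (⋃₀ 𝒟) x := by
      rw [← h]
      exact subset_antisymm (isPreconnected_connectedComponentIn.subset_connectedComponentIn
        (mem_connectedComponentIn hx.2) (subset_inter hsubV (connectedComponentIn_subset _ _)))
        (connectedComponentIn_mono x inter_subset_right)
    rw [this]
    exact mem_of_isComponent_sUnion (fun D hD => (hJ D hD).1)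
      (fun D hD => (hJ D hD).isPreconnected) hdis'
      (isComponent_connectedComponentIn (h ▸ hx))
  constructor
  · intro hD
    have hDV : D ⊆ V ∩ 𝒰 := h ▸ subset_sUnion_of_mem hD
    obtain ⟨x, hx⟩ := (hJ D hD).2.1.nonempty
    have hx' := hDV hx
    have hC := key x hx'
    have : D = connectedComponentIn 𝒰 x := by
      by_contra hne
      exact (hdis' hD hC hne).le_bot ⟨hx, mem_connectedComponentIn hx'.2⟩
    exact ⟨⟨x, hx'.2, this⟩, hDV.trans inter_subset_left⟩
  · rintro ⟨hD, hDV⟩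
    obtain ⟨x, hx⟩ := hD.nonempty
    rw [hD.eq_connectedComponentIn hx]
    exact key x ⟨hDV hx, hD.subset hx⟩

/-- A component of the domain that is mapped out of the domain by some iterate meets deep
pullbacks in a relatively compact set. -/
lemma exists_compact_of_isComponent (hfin : {U | IsComponent U 𝒰}.Finite) (n : ℕ) :
    ∀ U, IsComponent U 𝒰 → ∀ z ∈ U, IterDefined F 𝒰 n z → F^[n] z ∉ 𝒰 →
      ∃ Q, IsCompact Q ∧ Q ⊆ U ∧ ∃ M, pullback F 𝒰 𝒱 M ∩ U ⊆ Q := by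
  induction n with
  | zero => exact fun U hU z hz _ hn => absurd (hU.subset hz) hn
  | succ n ih =>
    intro U hU z hz hdef hn
    rw [iterDefined_succ] at hdef
    have hV := hF.image_component U hU
    -- Properness of the branch pulls a compact subset of `F '' U` back to one of `U`, at the cost
    -- of one more level of depth.
    suffices h : ∃ Q, IsCompact Q ∧ Q ⊆ F '' U ∧ ∃ M, pullback F 𝒰 𝒱 M ∩ F '' U ⊆ Q by
      obtain ⟨Q, hQ, hQU, M, hM⟩ := h
      refine ⟨U ∩ F ⁻¹' Q, hF.isCompact_inter_preimage hU hQ hQU, inter_subset_left, M + 1, ?_⟩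
      rintro y ⟨hy, hyU⟩
      rw [pullback_succ] at hy
      exact ⟨hyU, hM ⟨hy.2, mem_image_of_mem F hyU⟩⟩
    rcases hF.dom_disks _ hV with hVU | ⟨𝒟, hJ, hdis, heq⟩
    · exact ih _ hVU (F z) (mem_image_of_mem F hz) hdef.2 hn
    · have hfin' : 𝒟.Finite := hfin.subset fun D hD =>
        ((isComponent_iff_mem_of_inter_eq hF.dom_subset hV (fun D hD => (hJ D hD).1) hdis
          heq).1 hD).1
      -- Finiteness matters here: the closure of the union is the union of the closures, whereas
      -- infinitely many disks could accumulate on the boundary of `F '' U`.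
      refine ⟨closure (F '' U ∩ 𝒰), ?_, ?_, 1, ?_⟩
      · exact (hF.isBounded_cod.subset (inter_subset_left.trans hV.subset)).isCompact_closure
      · rw [heq, hfin'.closure_sUnion]
        exact iUnion₂_subset fun D hD => (hJ D hD).2
      · rw [hF.pullback_one, inter_comm]
        exact subset_closure

variable (hperm : NoPermutation F 𝒰) (hfin : {U | IsComponent U 𝒰}.Finite)

include hperm hfin

lemma exists_compact_of_pullback :
    ∃ Q N, IsCompact Q ∧ Q ⊆ 𝒰 ∧ pullback F 𝒰 𝒱 N ⊆ Q := by
  have h : ∀ U, IsComponent U 𝒰 → ∃ Q, IsCompact Q ∧ Q ⊆ U ∧ ∃ M, pullback F 𝒰 𝒱 M ∩ U ⊆ Q := by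
    intro U hU
    obtain ⟨n, z, hz, hdef, hn⟩ := hperm U hU
    exact hF.exists_compact_of_isComponent hfin n U hU z hz hdef hn
  choose! Q hQ hQU M hM using h
  obtain ⟨N, hN⟩ : ∃ N, ∀ U, IsComponent U 𝒰 → M U ≤ N := by
    obtain ⟨N, hN⟩ := (hfin.image M).bddAbove
    exact ⟨N, fun U hU => hN (mem_image_of_mem M hU)⟩
  -- Depth `N + 1` instead of `N` guarantees that the points lie in `𝒰`.
  refine ⟨⋃ U ∈ {U | IsComponent U 𝒰}, Q U, N + 1, hfin.isCompact_biUnion hQ,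
    iUnion₂_subset fun U hU => (hQU U hU).trans hU.subset, fun z hz => ?_⟩
  have hzU : z ∈ 𝒰 := by
    rw [pullback_succ] at hz
    exact hz.1
  have hU := isComponent_connectedComponentIn hzU
  exact mem_biUnion hU (hM _ hU ⟨hF.pullback_antitone ((hN _ hU).trans (Nat.le_succ N)) hz,
    mem_connectedComponentIn hzU⟩)

/-- Deep pullbacks are uniformly compactly contained in shallower ones. -/
lemma exists_compact_between_pullbacks :
    ∃ N, ∀ n, ∃ Q, IsCompact Q ∧ pullback F 𝒰 𝒱 (n + N) ⊆ Q ∧ Q ⊆ pullback F 𝒰 𝒱 n := by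
  obtain ⟨Q, N, hQ, hQU, hN⟩ := hF.exists_compact_of_pullback hperm hfin
  refine ⟨N, fun n => ?_⟩
  induction n with
  | zero => exact ⟨Q, hQ, by rwa [zero_add], by rw [pullback_zero]; exact hQU.trans hF.dom_subset⟩
  | succ n ih =>
    obtain ⟨Q', hQ', h1, h2⟩ := ih
    refine ⟨Q ∩ F ⁻¹' Q', hQ.of_isClosed_subset ?_ inter_subset_left, ?_, ?_⟩
    · exact (hF.holomorphic.continuousOn.mono hQU).preimage_isClosed_of_isClosed hQ.isClosed
        hQ'.isClosed
    · refine subset_inter ((hF.pullback_antitone (by omega)).trans hN) ?_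
      rw [show n + 1 + N = n + N + 1 by omega, pullback_succ]
      exact inter_subset_right.trans (preimage_mono h1)
    · rw [pullback_succ]
      exact inter_subset_inter hQU (preimage_mono h2)

/-- The pullbacks are open, but compact sets interlace with them and have the same intersection. -/
lemma isCompact_nonEscaping : IsCompact (nonEscaping F 𝒰 𝒱) := by
  obtain ⟨N, h⟩ := hF.exists_compact_between_pullbacks hperm hfin
  choose Q hQ h1 h2 using h
  have : nonEscaping F 𝒰 𝒱 = ⋂ n, Q n :=
    subset_antisymm (subset_iInter fun n => (iInter_subset _ (n + N)).trans (h1 n))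
      (iInter_mono h2)
  rw [this]
  exact (hQ 0).of_isClosed_subset (isClosed_iInter fun n => (hQ n).isClosed) (iInter_subset _ 0)

end IsBoxMapping

end Pullback

variable {F : ℂ → ℂ} {𝒰 𝒱 : Set ℂ}

/-! ### Orbits avoiding the critical pieces: lifting, expansion, measure zero -/

lemma isLocalHomeomorphOn_of_deriv_ne_zero {f : ℂ → ℂ} {U P : Set ℂ} (hU : IsOpen U)
    (hf : DifferentiableOn ℂ f U) (hPU : P ⊆ U) (hP : ∀ z ∈ P, deriv f z ≠ 0) :
    IsLocalHomeomorphOn f P := by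
  refine .mk _ _ fun z hz => ?_
  have hs : HasStrictDerivAt f (deriv f z) z :=
    (hf.analyticAt (hU.mem_nhds (hPU hz))).hasStrictDerivAt
  have hF := hs.hasStrictFDerivAt_equiv (hP z hz)
  exact ⟨hF.toOpenPartialHomeomorph f, hF.mem_toOpenPartialHomeomorph_source, fun _ _ => rfl⟩

/-- The set of non-escaping points whose orbit avoids the puzzle pieces of depth `n` around the
critical points. -/
def avoidingSet (F : ℂ → ℂ) (𝒰 𝒱 : Set ℂ) (n : ℕ) : Set ℂ :=
  {x ∈ nonEscaping F 𝒰 𝒱 | ∀ k : ℕ, ∀ c ∈ crit F 𝒰,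
    c ∉ connectedComponentIn (pullback F 𝒰 𝒱 n) (F^[k] x)}

lemma mapsTo_avoidingSet (n : ℕ) :
    MapsTo F (avoidingSet F 𝒰 𝒱 n) (avoidingSet F 𝒰 𝒱 n) := fun x hx =>
  ⟨mapsTo_nonEscaping hx.1, fun k => by
    rw [← Function.iterate_succ_apply]; exact hx.2 (k + 1)⟩

lemma mapsTo_iterate_pullback (k n : ℕ) :
    MapsTo F^[k] (pullback F 𝒰 𝒱 (n + k)) (pullback F 𝒰 𝒱 n) := by
  induction k with
  | zero => exact fun x hx => hx
  | succ k ih =>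
    intro x hx
    rw [← add_assoc, pullback_succ] at hx
    exact ih hx.2

namespace IsBoxMapping

variable (hF : IsBoxMapping F 𝒰 𝒱)

include hF

/-- A proper local homeomorphism has finite fibres and is a covering. Properness comes from the
branch `U → F '' U`, and the local homeomorphism from the absence of critical points. The target is
the whole pullback; fibres over its other components are empty. -/
lemma isCoveringMap_component {n : ℕ} {x : ℂ} (hx : x ∈ pullback F 𝒰 𝒱 (n + 1))
    (hP : ∀ c ∈ crit F 𝒰, c ∉ connectedComponentIn (pullback F 𝒰 𝒱 (n + 1)) x)
    (hmaps : MapsTo F (connectedComponentIn (pullback F 𝒰 𝒱 (n + 1)) x) (pullback F 𝒰 𝒱 n)) :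
    IsCoveringMap hmaps.restrict := by
  set P := connectedComponentIn (pullback F 𝒰 𝒱 (n + 1)) x with hPdef
  have hPA : P ⊆ pullback F 𝒰 𝒱 (n + 1) := connectedComponentIn_subset _ _
  have hAU : pullback F 𝒰 𝒱 (n + 1) ⊆ 𝒰 := by rw [pullback_succ]; exact inter_subset_left
  have hcont : Continuous hmaps.restrict :=
    (hF.holomorphic.continuousOn.mono (hPA.trans hAU)).mapsToRestrict hmaps
  have hcomp : IsComponent P (pullback F 𝒰 𝒱 (n + 1)) := isComponent_connectedComponentIn hx
  set U := connectedComponentIn 𝒰 x with hUdef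
  have hU : IsComponent U 𝒰 := isComponent_connectedComponentIn (hAU hx)
  have hPU : P ⊆ U := connectedComponentIn_mono x hAU
  have hproper : IsProperMap hmaps.restrict := by
    have : LocallyCompactSpace (pullback F 𝒰 𝒱 n) := (hF.isOpen_pullback n).locallyCompactSpace
    refine isProperMap_iff_isCompact_preimage.2 ⟨hcont, fun K hK => ?_⟩
    have hK' : IsCompact ((↑) '' K : Set ℂ) := hK.image continuous_subtype_val
    have hKA : ((↑) '' K : Set ℂ) ⊆ pullback F 𝒰 𝒱 n := by
      rintro _ ⟨y, -, rfl⟩; exact y.2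
    have hKV : ((↑) '' K : Set ℂ) ⊆ 𝒱 := hKA.trans (hF.pullback_subset_cod n)
    have h1 := (hF.image_component U hU).isCompact_inter hF.isOpen_cod hK' hKV
    have h2 := hF.isCompact_inter_preimage hU h1 inter_subset_right
    have h3 := hcomp.isCompact_inter (hF.isOpen_pullback _) h2 (by
      rw [pullback_succ]
      exact fun y hy => ⟨hU.subset hy.1, hKA hy.2.1⟩)
    rw [Subtype.isCompact_iff]
    convert h3 using 1
    ext y
    constructor
    · rintro ⟨⟨y, hy⟩, hyK, rfl⟩
      exact ⟨⟨hPU hy, ⟨_, hyK, rfl⟩, mem_image_of_mem F (hPU hy)⟩, hy⟩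
    · rintro ⟨⟨-, ⟨w, hw, hwy⟩, -⟩, hy⟩
      refine ⟨⟨y, hy⟩, ?_, rfl⟩
      have : (hmaps.restrict) ⟨y, hy⟩ = w := Subtype.ext hwy.symm
      rw [mem_preimage, this]
      exact hw
  have hloc : IsLocalHomeomorph hmaps.restrict := by
    refine IsLocalHomeomorph.of_comp (g := ((↑) : pullback F 𝒰 𝒱 n → ℂ)) ?_
      (hF.isOpen_pullback n).isOpenEmbedding_subtypeVal.isLocalHomeomorph hcont
    have h1 : IsLocalHomeomorphOn F P := isLocalHomeomorphOn_of_deriv_ne_zero hF.isOpen_dom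
      hF.holomorphic (hPA.trans hAU) fun z hz h => hP z ⟨hAU (hPA hz), h⟩ hz
    have h2 : IsLocalHomeomorphOn ((↑) : P → ℂ) univ :=
      (hcomp.isOpen
        (hF.isOpen_pullback _)).isOpenEmbedding_subtypeVal.isLocalHomeomorph.isLocalHomeomorphOn
    rw [isLocalHomeomorph_iff_isLocalHomeomorphOn_univ]
    exact h1.comp h2 fun y _ => y.2
  rw [isCoveringMap_iff_isCoveringMapOn_univ]
  refine hproper.isClosedMap.isCoveringMapOn_of_isLocalHomeomorphOn (fun y _ => ?_)
    (by rw [preimage_univ]; exact hloc.isLocalHomeomorphOn)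
  refine (hproper.isCompact_preimage isCompact_singleton).finite ?_
  refine IsDiscrete.of_openPartialHomeomorph hmaps.restrict subset_rfl fun e he => ?_
  obtain ⟨e', h1, h2⟩ := hloc e
  exact ⟨e', h1, h2.symm⟩

/-- Holomorphic disks lift through puzzle pieces without critical points. -/
lemma exists_lift {n : ℕ} {x : ℂ} (hx : x ∈ pullback F 𝒰 𝒱 (n + 1))
    (hP : ∀ c ∈ crit F 𝒰, c ∉ connectedComponentIn (pullback F 𝒰 𝒱 (n + 1)) x)
    {φ : ℂ → ℂ} (hφ : DifferentiableOn ℂ φ (ball 0 1))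
    (hφA : MapsTo φ (ball 0 1) (pullback F 𝒰 𝒱 n)) (h0 : φ 0 = F x) :
    ∃ ψ : ℂ → ℂ, DifferentiableOn ℂ ψ (ball 0 1) ∧
      MapsTo ψ (ball 0 1) (pullback F 𝒰 𝒱 (n + 1)) ∧ ψ 0 = x ∧
      ∀ z ∈ ball (0 : ℂ) 1, F (ψ z) = φ z := by
  have hPA := connectedComponentIn_subset (pullback F 𝒰 𝒱 (n + 1)) x
  have hmaps : MapsTo F (connectedComponentIn (pullback F 𝒰 𝒱 (n + 1)) x)
      (pullback F 𝒰 𝒱 n) := fun y hy => by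
    have := hPA hy
    rw [pullback_succ] at this
    exact this.2
  have hcov := hF.isCoveringMap_component hx hP hmaps
  have : ContractibleSpace (ball (0 : ℂ) 1) :=
    (convex_ball (0 : ℂ) 1).contractibleSpace ⟨0, by simp⟩
  have : LocallyPathConnectedSpace (ball (0 : ℂ) 1) := isOpen_ball.locallyPathConnectedSpace
  obtain ⟨Ψ, ⟨hΨ0, hΨ⟩, -⟩ := hcov.existsUnique_continuousMap_lifts
    ⟨hφA.restrict, hφ.continuousOn.mapsToRestrict hφA⟩ ⟨0, by simp⟩
    ⟨x, mem_connectedComponentIn hx⟩ (Subtype.ext h0.symm)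
  classical
  -- The value `0` off the disk plays no role.
  set ψ : ℂ → ℂ := fun z => if hz : z ∈ ball (0 : ℂ) 1 then Ψ ⟨z, hz⟩ else 0 with hψ
  have hψz : ∀ z : ball (0 : ℂ) 1, ψ z = Ψ z := fun z => by simp only [hψ, z.2, dif_pos]
  have hlift : ∀ z ∈ ball (0 : ℂ) 1, F (ψ z) = φ z := fun z hz => by
    have := congr_arg Subtype.val (congr_fun hΨ ⟨z, hz⟩)
    rw [hψz ⟨z, hz⟩]
    exact this
  have hmem : ∀ z ∈ ball (0 : ℂ) 1, ψ z ∈ connectedComponentIn (pullback F 𝒰 𝒱 (n + 1)) x :=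
    fun z hz => by rw [hψz ⟨z, hz⟩]; exact (Ψ ⟨z, hz⟩).2
  have hψc : ContinuousOn ψ (ball 0 1) := by
    rw [continuousOn_iff_continuous_domRestrict]
    have : (ball (0 : ℂ) 1).domRestrict ψ = fun z => ((Ψ z : _) : ℂ) := funext hψz
    rw [this]
    fun_prop
  have hψU : ∀ z ∈ ball (0 : ℂ) 1, ψ z ∈ 𝒰 := fun z hz => by
    have := hPA (hmem z hz)
    rw [pullback_succ] at this
    exact this.1
  refine ⟨ψ, fun z hz => ?_, fun z hz => hPA (hmem z hz), ?_, hlift⟩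
  · have hnhds := isOpen_ball.mem_nhds hz
    exact (differentiableAt_of_comp_eq hF.isOpen_dom hF.holomorphic (hψU z hz)
      (fun h => hP _ ⟨hψU z hz, h⟩ (hmem z hz)) (hψc.continuousAt hnhds)
      (hφ.differentiableAt hnhds)
      (by filter_upwards [hnhds] with y hy using hlift y hy)).differentiableWithinAt
  · rw [hψz ⟨0, by simp⟩, hΨ0]

/-- Lifting goes one iterate at a time. A deeper piece lies in the depth `n` piece around the same
point, so avoiding the critical pieces of depth `n` suffices at every stage. -/
lemma exists_iterate_lift {n k : ℕ} : ∀ {x : ℂ} (_ : x ∈ avoidingSet F 𝒰 𝒱 n)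
    {φ : ℂ → ℂ} (_ : DifferentiableOn ℂ φ (ball 0 1))
    (_ : MapsTo φ (ball 0 1) (pullback F 𝒰 𝒱 n)) (_ : φ 0 = F^[k] x),
    ∃ ψ : ℂ → ℂ, DifferentiableOn ℂ ψ (ball 0 1) ∧
      MapsTo ψ (ball 0 1) (pullback F 𝒰 𝒱 (n + k)) ∧ ψ 0 = x ∧
      ∀ z ∈ ball (0 : ℂ) 1, F^[k] (ψ z) = φ z := by
  induction k with
  | zero => exact fun _ _ hφ hφA h0 => ⟨_, hφ, hφA, h0, fun _ _ => rfl⟩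
  | succ k ih =>
    intro x hx φ hφ hφA h0
    obtain ⟨ψ', hψ', hA', h0', hl'⟩ := ih (mapsTo_avoidingSet n hx) hφ hφA h0
    obtain ⟨ψ, hψ, hA, h0, hl⟩ := hF.exists_lift (n := n + k) (mem_iInter.1 hx.1 (n + k + 1))
      (fun c hc hc' => hx.2 0 c hc
        (connectedComponentIn_mono x (hF.pullback_antitone (by omega)) hc')) hψ' hA' h0'
    exact ⟨ψ, hψ, hA, h0, fun z hz => by rw [Function.iterate_succ_apply, hl z hz, hl' z hz]⟩

lemma differentiableOn_iterate (k : ℕ) : DifferentiableOn ℂ F^[k] (pullback F 𝒰 𝒱 k) := by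
  induction k with
  | zero => exact differentiableOn_id
  | succ k ih =>
    rw [pullback_succ, Function.iterate_succ]
    exact ih.comp (hF.holomorphic.mono inter_subset_left) fun z hz => hz.2

lemma deriv_iterate_mul_deriv {k : ℕ} {φ ψ : ℂ → ℂ}
    (hψ : DifferentiableOn ℂ ψ (ball 0 1)) (hA : MapsTo ψ (ball 0 1) (pullback F 𝒰 𝒱 k))
    (hl : ∀ z ∈ ball (0 : ℂ) 1, F^[k] (ψ z) = φ z) {z : ℂ} (hz : z ∈ ball (0 : ℂ) 1) :
    deriv F^[k] (ψ z) * deriv ψ z = deriv φ z := by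
  have hnhds := isOpen_ball.mem_nhds hz
  rw [← deriv_comp z ((hF.differentiableOn_iterate k).differentiableAt
    ((hF.isOpen_pullback k).mem_nhds (hA hz))) (hψ.differentiableAt hnhds)]
  refine EventuallyEq.deriv_eq ?_
  filter_upwards [hnhds] with y hy using hl y hy

/-- Extremal disks lift. Together with the Schwarz-Pick bound
`enorm_deriv_iterate_mul_kobayashiRadius_le` this makes `F^[k]` an infinitesimal isometry at `x`. -/
lemma kobayashiRadius_iterate_le {n k : ℕ} {x : ℂ} (hx : x ∈ avoidingSet F 𝒰 𝒱 n) :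
    kobayashiRadius (pullback F 𝒰 𝒱 n) (F^[k] x) ≤
      ‖deriv F^[k] x‖ₑ * kobayashiRadius (pullback F 𝒰 𝒱 (n + k)) x := by
  refine iSup₂_le fun φ hφ => ?_
  obtain ⟨ψ, hψ, hA, rfl, hl⟩ := hF.exists_iterate_lift hx hφ.1 hφ.2.1 hφ.2.2
  rw [← hF.deriv_iterate_mul_deriv hψ (hA.mono_right (hF.pullback_antitone (by omega))) hl
    (by simp), enorm_mul]
  gcongr
  exact le_kobayashiRadius hψ hA rfl

lemma enorm_deriv_iterate_mul_kobayashiRadius_le (n k : ℕ) (x : ℂ) :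
    ‖deriv F^[k] x‖ₑ * kobayashiRadius (pullback F 𝒰 𝒱 (n + k)) x ≤
      kobayashiRadius (pullback F 𝒰 𝒱 n) (F^[k] x) :=
  enorm_deriv_mul_kobayashiRadius_le (hF.isOpen_pullback k) (hF.differentiableOn_iterate k)
    (hF.pullback_antitone (by omega)) (mapsTo_iterate_pullback k n)

variable (hperm : NoPermutation F 𝒰) (hfin : {U | IsComponent U 𝒰}.Finite)

include hperm hfin

lemma exists_ball_subset_pullback (n : ℕ) :
    ∃ r > 0, ∀ y ∈ nonEscaping F 𝒰 𝒱, ball y r ⊆ pullback F 𝒰 𝒱 n := by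
  obtain ⟨r, hr, h⟩ := (hF.isCompact_nonEscaping hperm hfin).exists_thickening_subset_open
    (hF.isOpen_pullback n) (iInter_subset _ n)
  exact ⟨r, hr, fun y hy => (ball_subset_thickening hy r).trans h⟩

/-- The critical pieces form an open set `W`, and the iterates are continuous on the compact
non-escaping set, so avoiding `W` is a closed condition. -/
lemma isCompact_avoidingSet (n : ℕ) : IsCompact (avoidingSet F 𝒰 𝒱 n) := by
  have hK := hF.isCompact_nonEscaping hperm hfin
  set W : Set ℂ := ⋃ c ∈ crit F 𝒰, connectedComponentIn (pullback F 𝒰 𝒱 n) c with hW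
  have hWo : IsOpen W := isOpen_biUnion fun c _ => (hF.isOpen_pullback n).connectedComponentIn
  have : avoidingSet F 𝒰 𝒱 n = ⋂ k : ℕ, nonEscaping F 𝒰 𝒱 ∩ F^[k] ⁻¹' Wᶜ := by
    ext x
    simp only [avoidingSet, mem_ofPred_eq, mem_iInter, mem_inter_iff, mem_preimage, mem_compl_iff,
      forall_and, forall_const, hW, mem_iUnion, not_exists]
    refine and_congr_right fun hx => forall_congr' fun k => forall₂_congr fun c hc => ?_
    rw [not_iff_not]
    constructor
    · intro h
      rw [← connectedComponentIn_eq h]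
      exact mem_connectedComponentIn (mem_iInter.1 (iterate_mem_nonEscaping hx k) n)
    · intro h
      rw [← connectedComponentIn_eq h]
      exact mem_connectedComponentIn (connectedComponentIn_nonempty_iff.1 ⟨_, h⟩)
  rw [this]
  refine hK.of_isClosed_subset (isClosed_iInter fun k => ?_)
    ((iInter_subset _ 0).trans inter_subset_left)
  exact ((hF.holomorphic.continuousOn.mono nonEscaping_subset).iterate
    mapsTo_nonEscaping k).preimage_isClosed_of_isClosed hK.isClosed hWo.isClosed_compl

/-- The iterates of a box mapping expand along orbits that avoid the critical puzzle pieces. -/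
lemma exists_lt_norm_deriv_iterate {n : ℕ} {x : ℂ} (hx : x ∈ avoidingSet F 𝒰 𝒱 n) (M : ℝ) :
    ∃ k, M < ‖deriv F^[k] x‖ := by
  obtain ⟨N, hN⟩ := hF.exists_compact_between_pullbacks hperm hfin
  obtain ⟨Q, hQ, hQ1, hQ2⟩ := hN n
  obtain ⟨q, hq1, hqt, hq⟩ := exists_mul_kobayashiRadius_le hQ (hF.isOpen_pullback n) hQ1 hQ2
  obtain ⟨r, hr, hball⟩ := hF.exists_ball_subset_pullback hperm hfin n
  obtain ⟨C, hC⟩ := hF.isBounded_cod.subset_closedBall 0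
  set R : ℕ → ℝ≥0∞ := fun m => kobayashiRadius (pullback F 𝒰 𝒱 m) x with hR
  have hC' : R n ≤ ENNReal.ofReal (2 * C) := kobayashiRadius_le_of_subset_closedBall
    ((hF.pullback_subset_cod n).trans hC)
  have hlow : ∀ k, ENNReal.ofReal r ≤ ‖deriv F^[k] x‖ₑ * R (n + k) := fun k =>
    (ofReal_le_kobayashiRadius hr (hball _ (iterate_mem_nonEscaping hx.1 k))).trans
      (hF.kobayashiRadius_iterate_le hx)
  have hr' : 0 < ENNReal.ofReal r := ENNReal.ofReal_pos.2 hr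
  -- The contraction between depths `n` and `n + N` at `F^[k] x` is transported to `x`: Schwarz-Pick
  -- at depth `n + N`, lifting at depth `n`. The factor `q` does not depend on `k`.
  have hstep : ∀ k, q * R (n + k + N) ≤ R (n + k) := by
    intro k
    have hD0 : ‖deriv F^[k] x‖ₑ ≠ 0 := fun h => by
      have := hlow k
      rw [h, zero_mul] at this
      exact absurd hr' (not_lt.2 this)
    refine (ENNReal.mul_le_mul_iff_right hD0 enorm_ne_top).1 ?_
    calc ‖deriv F^[k] x‖ₑ * (q * R (n + k + N))
        = q * (‖deriv F^[k] x‖ₑ * R (n + N + k)) := by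
          rw [mul_left_comm, add_right_comm]
      _ ≤ q * kobayashiRadius (pullback F 𝒰 𝒱 (n + N)) (F^[k] x) := by
          gcongr
          exact hF.enorm_deriv_iterate_mul_kobayashiRadius_le (n + N) k x
      _ ≤ kobayashiRadius (pullback F 𝒰 𝒱 n) (F^[k] x) := hq _
      _ ≤ _ := hF.kobayashiRadius_iterate_le hx
  have hpow : ∀ j, q ^ j * R (n + j * N) ≤ R n := by
    intro j
    induction j with
    | zero => simp
    | succ j ih =>
      refine le_trans ?_ ih
      rw [pow_succ, mul_assoc, show n + (j + 1) * N = n + j * N + N by ring]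
      gcongr
      exact hstep _
  by_contra! hcon
  -- The radius at `x` decays like `q ^ (-j)` while its product with the derivative stays at least
  -- `r`, so bounded derivatives would bound `q ^ j`.
  have hb : ∀ j, ENNReal.ofReal r * q ^ j ≤ ENNReal.ofReal M * ENNReal.ofReal (2 * C) := by
    intro j
    calc ENNReal.ofReal r * q ^ j ≤ ‖deriv F^[j * N] x‖ₑ * R (n + j * N) * q ^ j := by
          gcongr
          exact hlow _
      _ = ‖deriv F^[j * N] x‖ₑ * (q ^ j * R (n + j * N)) := by ring
      _ ≤ _ := by
          gcongr
          · rw [← ofReal_norm]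
            exact ENNReal.ofReal_le_ofReal (hcon _)
          · exact (hpow j).trans hC'
  have htend : Tendsto (fun j => ENNReal.ofReal r * q ^ j) atTop (𝓝 ∞) := by
    have h1 : Tendsto (fun j => q ^ j) atTop (𝓝 ∞) :=
      ENNReal.tendsto_pow_atTop_nhds_top_iff.2 hq1
    have := ENNReal.Tendsto.const_mul (a := ENNReal.ofReal r) h1 (.inl ENNReal.top_ne_zero)
    rwa [ENNReal.mul_top hr'.ne'] at this
  have := le_of_tendsto' htend hb
  rw [top_le_iff] at this
  exact ENNReal.mul_ne_top ENNReal.ofReal_ne_top ENNReal.ofReal_ne_top this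

/-- On a disk inside the set all iterates are defined and uniformly bounded, so the Cauchy estimate
bounds their derivatives at the centre, against expansion. -/
lemma interior_avoidingSet (n : ℕ) : interior (avoidingSet F 𝒰 𝒱 n) = ∅ := by
  by_contra hne
  obtain ⟨x, hx⟩ := nonempty_iff_ne_empty.2 hne
  obtain ⟨ρ, hρ, hsub⟩ := Metric.isOpen_iff.1 isOpen_interior x hx
  replace hsub := hsub.trans interior_subset
  obtain ⟨C, hC⟩ := hF.isBounded_cod.subset_closedBall 0
  obtain ⟨k, hk⟩ := hF.exists_lt_norm_deriv_iterate hperm hfin (hsub (mem_ball_self hρ))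
    (2 * C / ρ)
  refine absurd hk (not_lt.2 ?_)
  refine Complex.norm_deriv_le_div_of_mapsTo_ball ((hF.differentiableOn_iterate k).mono
    (hsub.trans fun y hy => mem_iInter.1 hy.1 k)) (fun z hz => ?_) hρ
  have h : ∀ y ∈ ball x ρ, F^[k] y ∈ closedBall (0 : ℂ) C := fun y hy =>
    hC (hF.dom_subset (nonEscaping_subset (iterate_mem_nonEscaping (hsub hy).1 k)))
  have h1 := h z hz
  have h2 := h x (mem_ball_self hρ)
  rw [mem_closedBall] at h1 h2 ⊢
  have := dist_triangle_right (F^[k] z) (F^[k] x) 0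
  linarith

/-- The inverse branches are lifts of round disks of radius `r` about `F^[k] x`. They are injective
since following them by `F^[k]` gives an affine map, and contracting since `F^[k]` expands. -/
lemma volume_avoidingSet (n : ℕ) : volume (avoidingSet F 𝒰 𝒱 n) = 0 := by
  obtain ⟨r, hr, hball⟩ := hF.exists_ball_subset_pullback hperm hfin n
  have hr0 : (r : ℂ) ≠ 0 := by exact_mod_cast hr.ne'
  refine volume_eq_zero_of_inverse_branches (hF.isCompact_avoidingSet hperm hfin n)
    (hF.interior_avoidingSet hperm hfin n) hr fun x hx ε hε => ?_
  obtain ⟨k, hk⟩ := hF.exists_lt_norm_deriv_iterate hperm hfin hx (r / ε)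
  have hd : ∀ z : ℂ, deriv (fun z : ℂ => F^[k] x + r * z) z = r := fun z => by
    simp
  obtain ⟨ψ, hψ, hA, h0, hl⟩ := hF.exists_iterate_lift hx (k := k)
    (φ := fun z => F^[k] x + r * z) (by fun_prop) (fun z hz => by
      apply hball _ (iterate_mem_nonEscaping hx.1 k)
      rw [mem_ball_zero_iff] at hz
      rw [mem_ball, dist_eq_norm, add_sub_cancel_left, norm_mul, Complex.norm_real,
        Real.norm_of_nonneg hr.le]
      nlinarith) (by simp)
  have hder : ∀ z ∈ ball (0 : ℂ) 1, deriv F^[k] (ψ z) * deriv ψ z = r := fun z hz => by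
    rw [hF.deriv_iterate_mul_deriv hψ (hA.mono_right (hF.pullback_antitone (by omega))) hl hz, hd]
  refine ⟨F^[k] x, (mapsTo_avoidingSet n).iterate k hx, ψ, hψ, ?_, ?_, h0, ?_, ?_⟩
  · intro z hz w hw hzw
    have := hl z hz
    rw [hzw, hl w hw] at this
    exact (mul_left_cancel₀ hr0 (add_left_cancel this)).symm
  · intro z hz h
    have := hder z hz
    rw [h, mul_zero] at this
    exact hr0 this.symm
  · have := congr_arg norm (hder 0 (by simp))
    rw [h0, norm_mul, Complex.norm_real, Real.norm_of_nonneg hr.le] at this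
    rw [div_lt_iff₀ hε, ← this] at hk
    exact lt_of_mul_lt_mul_left hk (norm_nonneg _)
  · intro z hz hzE
    rw [← hl z hz]
    exact (mapsTo_avoidingSet n).iterate k hzE

omit hperm hfin in
-- A puzzle neighborhood consists of finitely many pieces, so their depths have a bound `n`, and it
-- contains the depth `n` pieces around the critical points. With no critical points any depth will
-- do.
lemma offCrit_subset : offCrit F 𝒰 𝒱 ⊆ ⋃ n, avoidingSet F 𝒰 𝒱 n := by
  rintro x ⟨hx, h⟩
  rw [mem_iUnion]
  by_cases hne : (crit F 𝒰).Nonempty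
  · obtain ⟨W, ⟨⟨𝒬, hfin, hpiece, rfl⟩, hsub, -⟩, hW⟩ := h hne
    choose! d hd using hpiece
    obtain ⟨n, hn⟩ := (hfin.image d).bddAbove
    refine ⟨n, hx, fun k c hc hc' => hW k ?_⟩
    obtain ⟨P, hP, hcP⟩ := hsub hc
    refine ⟨P, hP, ?_⟩
    have hdn : d P ≤ n := hn (mem_image_of_mem d hP)
    exact (hd P hP).subset_of_isPreconnected isPreconnected_connectedComponentIn
      ((connectedComponentIn_subset _ _).trans (hF.pullback_antitone hdn)) hc' hcP
      (mem_connectedComponentIn (mem_iInter.1 (iterate_mem_nonEscaping hx k) n))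
  · exact ⟨0, hx, fun k c hc => absurd ⟨c, hc⟩ hne⟩

lemma volume_offCrit : volume (offCrit F 𝒰 𝒱) = 0 :=
  measure_mono_null hF.offCrit_subset
    (measure_iUnion_null fun n => hF.volume_avoidingSet hperm hfin n)

end IsBoxMapping

/-! ### Positivity of the modulus -/

/-- Projecting the curve to the direction of its chord gives a real Lipschitz function, to which the
fundamental theorem of calculus for absolutely continuous functions applies. -/
lemma ofReal_norm_sub_le_lintegral_enorm_deriv {γ : ℝ → ℂ} {K : ℝ≥0} (hγ : LipschitzWith K γ)
    {a b : ℝ} (hab : a ≤ b) :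
    ENNReal.ofReal ‖γ b - γ a‖ ≤ ∫⁻ t in Ioo a b, ‖deriv γ t‖ₑ := by
  set v : ℂ := γ b - γ a with hv
  by_cases hv0 : v = 0
  · simp [hv0]
  set L : ℂ →L[ℝ] ℝ := Complex.reCLM.comp
    (ContinuousLinearMap.mul ℝ ℂ (starRingEnd ℂ v)) with hL
  have hLle : ∀ w, ‖L w‖ ≤ ‖v‖ * ‖w‖ := fun w => by
    simp only [hL, ContinuousLinearMap.comp_apply, ContinuousLinearMap.mul_apply',
      Complex.reCLM_apply]
    refine (Complex.abs_re_le_norm _).trans ?_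
    rw [norm_mul, RCLike.norm_conj]
  have hLv : L v = ‖v‖ ^ 2 := by
    simp only [hL, ContinuousLinearMap.comp_apply, ContinuousLinearMap.mul_apply',
      Complex.reCLM_apply]
    rw [mul_comm, Complex.mul_conj, Complex.normSq_eq_norm_sq, Complex.ofReal_re]
  have hac : AbsolutelyContinuousOnInterval (fun t => L (γ t)) a b :=
    ((L.lipschitz.comp hγ).lipschitzOnWith (s := uIcc a b)).absolutelyContinuousOnInterval
  have hint := hac.integral_deriv_eq_sub
  rw [← map_sub, ← hv, hLv, intervalIntegral.integral_of_le hab] at hint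
  have h1 : ‖(‖v‖ ^ 2 : ℝ)‖ₑ ≤ ∫⁻ t in Ioc a b, ‖v‖ₑ * ‖deriv γ t‖ₑ := by
    rw [← hint]
    refine (enorm_integral_le_lintegral_enorm _).trans (lintegral_mono_ae ?_)
    refine ae_restrict_of_ae ?_
    filter_upwards [hγ.ae_differentiableAt_real] with t ht
    have : deriv (fun t => L (γ t)) t = L (deriv γ t) :=
      (L.hasFDerivAt.comp_hasDerivAt t ht.hasDerivAt).deriv
    rw [this, ← enorm_mul, ← ofReal_norm, ← ofReal_norm, norm_mul]
    exact ENNReal.ofReal_le_ofReal (hLle _)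
  rw [lintegral_const_mul' _ _ enorm_ne_top, setLIntegral_congr Ioo_ae_eq_Ioc.symm, pow_two,
    enorm_mul, enorm_norm] at h1
  rw [ofReal_norm]
  exact (ENNReal.mul_le_mul_iff_right (enorm_ne_zero.2 hv0) enorm_ne_top).1 h1

/-- A path that ends outside an open set reaches the frontier from any point of the set. -/
lemma exists_mem_frontier_of_path {V : Set ℂ} (hV : IsOpen V) {γ : ℝ → ℂ} (hγ : Continuous γ)
    (h0 : γ 0 ∈ V) (h1 : γ 1 ∉ V) : ∃ t ∈ Icc (0 : ℝ) 1, γ t ∈ frontier V := by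
  by_contra! h
  have hpre : IsPreconnected (γ '' Icc 0 1) := isPreconnected_Icc.image _ hγ.continuousOn
  have hsub : γ '' Icc 0 1 ⊆ V := by
    refine hpre.subset_of_closure_inter_subset hV ⟨γ 0, ⟨0, by simp, rfl⟩, h0⟩ ?_
    rintro _ ⟨hz, t, ht, rfl⟩
    by_contra hn
    exact h t ht (by rw [hV.frontier_eq]; exact ⟨hz, hn⟩)
  exact h1 (hsub ⟨1, by simp, rfl⟩)

/-- One admissible metric of finite area is enough: the constant `1 / d` on a collar of width `d`
around the frontier of `V`, chosen disjoint from `closure U`. Every joining curve crosses the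
collar. -/
lemma modulus_pos {V U : Set ℂ} (hV : IsOpen V) (hUV : closure U ⊆ V)
    (hc : IsCompact (frontier V)) (hne : (frontier V).Nonempty) : 0 < modulus V U := by
  have hA : V \ closure U ≠ ∅ := fun h => by
    have hcl : closure U = V := subset_antisymm hUV (sdiff_eq_empty.1 h)
    have : IsClopen V := ⟨hcl ▸ isClosed_closure, hV⟩
    rw [this.frontier_eq] at hne
    exact not_nonempty_empty hne
  rw [modulus, if_neg hA, extremalDistance, ENNReal.inv_pos]
  obtain ⟨d, hd, hsub⟩ := hc.exists_thickening_subset_open isClosed_closure.isOpen_compl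
    (t := (closure U)ᶜ) (fun z hz hz' =>
      (disjoint_frontier_iff_isOpen.2 hV).le_bot ⟨hz, hUV hz'⟩)
  set T := thickening d (frontier V) with hT
  have hTm : MeasurableSet T := isOpen_thickening.measurableSet
  set ρ : ℂ → ℝ≥0∞ := T.indicator fun _ => ENNReal.ofReal d⁻¹ with hρ
  refine ne_top_of_le_ne_top ?_ (iInf₂_le ρ ⟨measurable_const.indicator hTm, ?_⟩)
  · have hle : ∫⁻ z in V \ closure U, ρ z ^ 2 ≤ ∫⁻ z, T.indicator
        (fun _ => ENNReal.ofReal d⁻¹ ^ 2) z := by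
      refine (setLIntegral_le_lintegral _ _).trans (lintegral_mono fun z => ?_)
      by_cases hz : z ∈ T <;> simp [hρ, hz]
    refine ne_top_of_le_ne_top ?_ hle
    rw [lintegral_indicator_const hTm]
    exact ENNReal.mul_ne_top (ENNReal.pow_ne_top ENNReal.ofReal_ne_top)
      (hc.isBounded.thickening.measure_lt_top).ne
  · rintro γ ⟨⟨K, hγ⟩, h0, h1, -⟩
    obtain ⟨b, hb, hbV⟩ := exists_mem_frontier_of_path hV hγ.continuous (hUV h0) h1
    set S : Set ℝ := Icc 0 b ∩ γ ⁻¹' Tᶜ with hS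
    have hSc : IsCompact S := isCompact_Icc.inter_right
      ((isOpen_thickening.isClosed_compl).preimage hγ.continuous)
    have h0T : γ 0 ∉ T := fun h => hsub h h0
    -- `a` is the last time before `b` outside the collar, so the curve stays in the collar on `(a,
    -- b)` and covers distance at least `d`.
    obtain ⟨a, ⟨⟨ha0, hab⟩, haT⟩, hmax⟩ := hSc.exists_isGreatest ⟨0, ⟨⟨le_rfl, hb.1⟩, h0T⟩⟩
    have hin : ∀ t ∈ Ioo a b, γ t ∈ T := fun t ht => by
      by_contra hn
      exact absurd (hmax ⟨⟨ha0.trans ht.1.le, ht.2.le⟩, hn⟩) (not_le.2 ht.1)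
    have hdist : d ≤ ‖γ b - γ a‖ := by
      by_contra! hlt
      refine haT (mem_thickening_iff.2 ⟨γ b, hbV, ?_⟩)
      rwa [dist_comm, dist_eq_norm]
    calc (1 : ℝ≥0∞) = ENNReal.ofReal d⁻¹ * ENNReal.ofReal d := by
          rw [← ENNReal.ofReal_mul (by positivity), inv_mul_cancel₀ hd.ne', ENNReal.ofReal_one]
      _ ≤ ENNReal.ofReal d⁻¹ * ∫⁻ t in Ioo a b, ‖deriv γ t‖ₑ := by
          gcongr
          exact (ENNReal.ofReal_le_ofReal hdist).trans
            (ofReal_norm_sub_le_lintegral_enorm_deriv hγ hab)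
      _ = ∫⁻ t in Ioo a b, ρ (γ t) * ‖deriv γ t‖ₑ := by
          rw [← lintegral_const_mul' _ _ ENNReal.ofReal_ne_top]
          refine setLIntegral_congr_fun measurableSet_Ioo fun t ht => ?_
          simp only [hρ, indicator_of_mem (hin t ht)]
      _ ≤ metricLength ρ γ :=
          lintegral_mono_set (Ioo_subset_Ioo ha0 hb.2)

/-! ### Box mappings with finitely many branches -/

namespace IsBoxMapping

variable (hF : IsBoxMapping F 𝒰 𝒱)

include hF

lemma closure_subset_of_ne {x : ℂ} (hx : x ∈ 𝒰)
    (hne : connectedComponentIn 𝒰 x ≠ connectedComponentIn 𝒱 x) :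
    closure (connectedComponentIn 𝒰 x) ⊆ connectedComponentIn 𝒱 x := by
  have hV := isComponent_connectedComponentIn (hF.dom_subset hx)
  rcases hF.dom_disks _ hV with h | ⟨𝒟, hJ, hdis, heq⟩
  · exact absurd (h.eq_connectedComponentIn
      (mem_connectedComponentIn (hF.dom_subset hx))).symm hne
  · exact (hJ _ ((isComponent_iff_mem_of_inter_eq hF.dom_subset hV (fun D hD => (hJ D hD).1) hdis
      heq).2 ⟨isComponent_connectedComponentIn hx, connectedComponentIn_mono x hF.dom_subset⟩)).2

lemma modulusAt_pos {x : ℂ} (hx : x ∈ 𝒰)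
    (hne : connectedComponentIn 𝒰 x ≠ connectedComponentIn 𝒱 x) : 0 < modulusAt 𝒰 𝒱 x := by
  have hJ := hF.isJordanDisk_of_isComponent
    (isComponent_connectedComponentIn (hF.dom_subset hx))
  exact modulus_pos hJ.1 (hF.closure_subset_of_ne hx hne) hJ.2.2.isCompact hJ.2.2.nonempty

/-- Without permutation of components, every non-escaping orbit keeps visiting components of the
domain that are not components of the range. -/
lemma exists_component_ne (hperm : NoPermutation F 𝒰) {y : ℂ} (hy : y ∈ nonEscaping F 𝒰 𝒱) :
    ∃ k, connectedComponentIn 𝒰 (F^[k] y) ≠ connectedComponentIn 𝒱 (F^[k] y) := by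
  by_contra! h
  have hmem : ∀ k, F^[k] y ∈ 𝒰 := fun k => nonEscaping_subset (iterate_mem_nonEscaping hy k)
  -- If every component visited is a full component of `𝒱`, then each image of the component of `y`
  -- is again a component of `𝒰`, and the whole component never escapes.
  have hmaps : ∀ k, ∀ z ∈ connectedComponentIn 𝒰 y,
      F^[k] z ∈ connectedComponentIn 𝒰 (F^[k] y) := by
    intro k z hz
    induction k with
    | zero => exact hz
    | succ k ih =>
      rw [h (k + 1), Function.iterate_succ_apply', Function.iterate_succ_apply',
        ← hF.image_eq_connectedComponentIn (isComponent_connectedComponentIn (hmem k))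
          (mem_connectedComponentIn (hmem k))]
      exact mem_image_of_mem F ih
  obtain ⟨n, z, hz, -, hn⟩ := hperm _ (isComponent_connectedComponentIn (hmem 0))
  exact hn (connectedComponentIn_subset _ _ (hmaps n z hz))

omit hF in
lemma _root_.BoxMap.modulusAt_eq_of_mem {x y : ℂ} (hsub : 𝒰 ⊆ 𝒱)
    (hy : y ∈ connectedComponentIn 𝒰 x) : modulusAt 𝒰 𝒱 y = modulusAt 𝒰 𝒱 x := by
  rw [modulusAt, modulusAt, connectedComponentIn_eq hy,
    connectedComponentIn_eq (connectedComponentIn_mono x hsub hy)]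

lemma exists_le_modulusAt (hfin : {U | IsComponent U 𝒰}.Finite) :
    ∃ δ : ℝ≥0∞, 0 < δ ∧ δ ≠ ∞ ∧ ∀ x ∈ 𝒰, modulusAt 𝒰 𝒱 x ≠ 0 → δ ≤ modulusAt 𝒰 𝒱 x := by
  classical
  have hvals : (modulusAt 𝒰 𝒱 '' 𝒰).Finite := by
    refine (hfin.image fun U => if h : U.Nonempty then modulusAt 𝒰 𝒱 h.some else 0).subset ?_
    rintro _ ⟨x, hx, rfl⟩
    have hne : (connectedComponentIn 𝒰 x).Nonempty := ⟨x, mem_connectedComponentIn hx⟩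
    refine ⟨_, isComponent_connectedComponentIn hx, ?_⟩
    simp only [dif_pos hne]
    exact modulusAt_eq_of_mem hF.dom_subset hne.some_mem
  -- `modulusAt` is constant on components, so it has finitely many values. Inserting `1` makes `T`
  -- nonempty and its minimum finite.
  set T : Set ℝ≥0∞ := insert 1 (modulusAt 𝒰 𝒱 '' 𝒰 \ {0}) with hT
  have hTfin : T.Finite := (hvals.subset sdiff_subset).insert 1
  obtain ⟨δ, hδ, hmin⟩ := T.exists_min_image id hTfin ⟨1, mem_insert _ _⟩
  refine ⟨δ, ?_, ne_top_of_le_ne_top ENNReal.one_ne_top (hmin 1 (mem_insert _ _)), ?_⟩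
  · rcases hδ with rfl | hδ
    · exact one_pos
    · exact pos_iff_ne_zero.2 hδ.2
  · exact fun x hx h0 => hmin _ (.inr ⟨mem_image_of_mem _ hx, h0⟩)

lemma nonEscaping_eq_wellInside (hperm : NoPermutation F 𝒰)
    (hfin : {U | IsComponent U 𝒰}.Finite) : nonEscaping F 𝒰 𝒱 = wellInside F 𝒰 𝒱 := by
  refine subset_antisymm (fun y hy => ⟨hy, ?_⟩) fun y hy => hy.1
  obtain ⟨δ, hδ0, hδt, hδ⟩ := hF.exists_le_modulusAt hfin
  have hδ' : 0 < δ.toReal := ENNReal.toReal_pos hδ0.ne' hδt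
  -- Halving gives the strict inequality; frequent visits only give `δ ≤ limsup`.
  refine ⟨δ.toReal / 2, by positivity, ?_⟩
  refine lt_of_lt_of_le (b := δ) ?_ (le_limsup_of_frequently_le' (frequently_atTop.2 fun k => ?_))
  · rw [ENNReal.ofReal_lt_iff_lt_toReal (by positivity) hδt]
    linarith
  · obtain ⟨j, hj⟩ := hF.exists_component_ne hperm (iterate_mem_nonEscaping hy k)
    rw [← Function.iterate_add_apply] at hj
    have hmem := nonEscaping_subset (iterate_mem_nonEscaping hy (j + k))
    exact ⟨j + k, by omega, hδ _ hmem (hF.modulusAt_pos hmem hj).ne'⟩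

/-- A box mapping with finitely many branches and without permutation of components is
dynamically natural. -/
theorem isDynamicallyNatural_of_finite (hperm : NoPermutation F 𝒰)
    (hfin : {U | IsComponent U 𝒰}.Finite) : IsDynamicallyNatural F 𝒰 𝒱 where
  isBoxMapping := hF
  noPermutation := hperm
  volume_offCrit := hF.volume_offCrit hperm hfin
  nonEscaping_eq := hF.nonEscaping_eq_wellInside hperm hfin

end IsBoxMapping

/-! ### Restriction to a family of components -/

lemma isComponent_sUnion_iff {𝒞 : Set (Set ℂ)} {S C : Set ℂ} (hS : IsOpen S)
    (h𝒞 : ∀ C ∈ 𝒞, IsComponent C S) : IsComponent C (⋃₀ 𝒞) ↔ C ∈ 𝒞 := by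
  have hdis : 𝒞.Pairwise Disjoint := by
    intro C hC C' hC' hne
    rw [Set.disjoint_left]
    intro x hx hx'
    exact hne (((h𝒞 C hC).eq_connectedComponentIn hx).trans
      ((h𝒞 C' hC').eq_connectedComponentIn hx').symm)
  have key : ∀ C, IsComponent C (⋃₀ 𝒞) → C ∈ 𝒞 := fun C =>
    mem_of_isComponent_sUnion (fun D hD => (h𝒞 D hD).isOpen hS)
      (fun D hD => (h𝒞 D hD).isPreconnected) hdis
  refine ⟨key C, fun hC => ?_⟩
  obtain ⟨x, hx⟩ := (h𝒞 C hC).nonempty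
  have hx' : x ∈ ⋃₀ 𝒞 := ⟨C, hC, hx⟩
  refine ⟨x, hx', ?_⟩
  by_contra hne
  exact (hdis hC (key _ (isComponent_connectedComponentIn hx')) hne).le_bot
    ⟨hx, mem_connectedComponentIn hx'⟩

section Restrict

variable {𝒞 : Set (Set ℂ)} (h𝒞 : ∀ C ∈ 𝒞, IsComponent C 𝒰)

include h𝒞

lemma crit_sUnion : crit F (⋃₀ 𝒞) = ⋃₀ 𝒞 ∩ crit F 𝒰 := by
  ext z
  constructor
  · rintro ⟨h1, h2⟩
    obtain ⟨C, hC, hz⟩ := h1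
    exact ⟨⟨C, hC, hz⟩, (h𝒞 C hC).subset hz, h2⟩
  · rintro ⟨h1, -, h2⟩
    exact ⟨h1, h2⟩

lemma NoPermutation.restrict (hU : IsOpen 𝒰) (hperm : NoPermutation F 𝒰) :
    NoPermutation F (⋃₀ 𝒞) := by
  classical
  intro U hUc
  have hUC := (isComponent_sUnion_iff hU h𝒞).1 hUc
  obtain ⟨n, z, hz, -, hn⟩ := hperm U (h𝒞 U hUC)
  -- Leaving `𝒰` implies leaving the smaller domain. The first exit time is needed so that all
  -- earlier iterates are defined for the restricted map.
  have hex : ∃ m, F^[m] z ∉ ⋃₀ 𝒞 := ⟨n, fun ⟨C, hC, h⟩ => hn ((h𝒞 C hC).subset h)⟩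
  exact ⟨Nat.find hex, z, hz, fun i hi => not_not.1 (Nat.find_min hex hi), Nat.find_spec hex⟩

lemma IsBoxMapping.restrict (hF : IsBoxMapping F 𝒰 𝒱) : IsBoxMapping F (⋃₀ 𝒞) 𝒱 := by
  have hsub : ⋃₀ 𝒞 ⊆ 𝒰 := sUnion_subset fun C hC => (h𝒞 C hC).subset
  have hcomp : ∀ {C}, IsComponent C (⋃₀ 𝒞) → IsComponent C 𝒰 := fun hC =>
    h𝒞 _ ((isComponent_sUnion_iff hF.isOpen_dom h𝒞).1 hC)
  refine ⟨isOpen_sUnion fun C hC => (h𝒞 C hC).isOpen hF.isOpen_dom, hF.isOpen_cod,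
    hsub.trans hF.dom_subset, hF.mapsTo.mono_left hsub, hF.holomorphic.mono hsub,
    hF.finite_crit.subset ?_, hF.cod_disks, fun V hV => ?_,
    fun U hU => hF.image_component U (hcomp hU), fun U hU => hF.proper U (hcomp hU)⟩
  · rw [crit_sUnion h𝒞]
    exact inter_subset_right
  · rcases hF.dom_disks V hV with h | ⟨𝒟, hJ, hdis, heq⟩
    · by_cases hVC : V ∈ 𝒞
      · exact .inl ((isComponent_sUnion_iff hF.isOpen_dom h𝒞).2 hVC)
      -- A component common to `𝒰` and `𝒱` that is discarded leaves no domain in `V`, which is the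
      -- alternative with an empty family of disks.
      · refine .inr ⟨∅, by simp, by simp, ?_⟩
        rw [sUnion_empty, ← disjoint_iff_inter_eq_empty, disjoint_sUnion_right]
        intro C hC
        rw [Set.disjoint_left]
        intro x hxV hxC
        exact hVC (((h.eq_connectedComponentIn hxV).trans
          ((h𝒞 C hC).eq_connectedComponentIn hxC).symm) ▸ hC)
    · refine .inr ⟨𝒟 ∩ 𝒞, fun D hD => hJ D hD.1, hdis.mono inter_subset_left, ?_⟩
      have hmem := @isComponent_iff_mem_of_inter_eq 𝒰 𝒱 V 𝒟 hF.dom_subset hV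
        (fun D hD => (hJ D hD).1) hdis heq
      ext x
      constructor
      · rintro ⟨hxV, C, hC, hxC⟩
        refine ⟨C, ⟨hmem.2 ⟨h𝒞 C hC, ?_⟩, hC⟩, hxC⟩
        exact hV.subset_of_isPreconnected (h𝒞 C hC).isPreconnected
          ((h𝒞 C hC).subset.trans hF.dom_subset) hxC hxV
      · rintro ⟨D, ⟨hD, hDC⟩, hx⟩
        exact ⟨(hmem.1 hD).2 hx, D, hDC, hx⟩

lemma IsBoxMapping.isInduced_restrict (hF : IsBoxMapping F 𝒰 𝒱) :
    IsInduced F (⋃₀ 𝒞) 𝒱 F 𝒰 𝒱 where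
  dom_union := ⟨𝒞, fun C hC => ⟨1, by rw [hF.pullback_one]; exact h𝒞 C hC⟩, rfl⟩
  cod_union := ⟨{V | IsComponent V 𝒱}, fun V hV => ⟨0, by rwa [pullback_zero]⟩,
    subset_antisymm (fun x hx => ⟨_, isComponent_connectedComponentIn hx,
      mem_connectedComponentIn hx⟩) (sUnion_subset fun V hV => hV.subset)⟩
  branch U hU := ⟨1, le_rfl, fun z hz => ⟨fun i hi => by
    obtain rfl : i = 0 := by omega
    exact (h𝒞 U ((isComponent_sUnion_iff hF.isOpen_dom h𝒞).1 hU)).subset hz, rfl⟩⟩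

end Restrict

end BoxMap

theorem proposition4p6 (F : ℂ → ℂ) (𝒰 𝒱 : Set ℂ)
    (hF : BoxMap.IsBoxMapping F 𝒰 𝒱) (hperm : BoxMap.NoPermutation F 𝒰)
    (hV : ∀ V, BoxMap.IsComponent V 𝒱 →
      (∃ c ∈ V, c ∈ BoxMap.crit F 𝒰) ∨ ∃ O : Set ℂ, IsOpen O ∧ O.Nonempty ∧ O ⊆ V ∧ Disjoint O 𝒰)
    (B : Set ℂ) (hB : BoxMap.IsFinitePuzzleUnion F 𝒰 𝒱 B) (hnice : BoxMap.IsNice F 𝒰 B)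
    (hcpt : BoxMap.CompactlyIn B 𝒱) :
    ∃ (F₁ : ℂ → ℂ) (𝒰₁ 𝒱₁ : Set ℂ),
      BoxMap.IsInduced F₁ 𝒰₁ 𝒱₁ F 𝒰 𝒱 ∧ BoxMap.IsDynamicallyNatural F₁ 𝒰₁ 𝒱₁ ∧
      BoxMap.critVisiting F 𝒰 B ⊆ BoxMap.crit F₁ 𝒰₁ ∧
      BoxMap.crit F₁ 𝒰₁ ⊆ BoxMap.crit F 𝒰 := by
  -- Keeping every component with a critical point preserves the whole critical set, and finiteness
  -- of that set leaves finitely many branches.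
  set 𝒞 : Set (Set ℂ) := connectedComponentIn 𝒰 '' BoxMap.crit F 𝒰 with h𝒞def
  have h𝒞 : ∀ C ∈ 𝒞, BoxMap.IsComponent C 𝒰 := by
    rintro _ ⟨c, hc, rfl⟩
    exact BoxMap.isComponent_connectedComponentIn hc.1
  have hfin : {U | BoxMap.IsComponent U (⋃₀ 𝒞)}.Finite :=
    (hF.finite_crit.image _).subset fun U hU =>
      (BoxMap.isComponent_sUnion_iff hF.isOpen_dom h𝒞).1 hU
  refine ⟨F, ⋃₀ 𝒞, 𝒱, hF.isInduced_restrict h𝒞,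
    (hF.restrict h𝒞).isDynamicallyNatural_of_finite (hperm.restrict h𝒞 hF.isOpen_dom) hfin, ?_, ?_⟩
  · rw [BoxMap.crit_sUnion h𝒞]
    exact fun c hc => ⟨⟨_, mem_image_of_mem _ hc.1, mem_connectedComponentIn hc.1.1⟩, hc.1⟩
  · rw [BoxMap.crit_sUnion h𝒞]
    exact inter_subset_right
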